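/- **Square with bands data.** For $N\ge 0$ let $P$ be a partition of $\{1,\dots,2N\}$ into pairs ("arcs"), $s:P\to\mathbb Z/2$ a function (arcs with $s=1$ are twisted), and $\overline P=P\cup\{\{0\},\{2N+1\}\}$. Assume that the surface obtained from a square by attaching to its right-hand edge one band for every arc (half-twisted if the arc is twisted) has exactly one boundary component; $N=0$ is allowed. Let $f:\overline P\to\mathbb N$ with $f(\{0\})=n$, $f(\{2N+1\})=m$. The vertex set $V$ consists of the points $(i,a)$ with $i\in p\in\overline P$, $a\in\{1,\dots,f(p)\}$, ordered by $i$, then by $a$ (increasing for $i\le 2N$, decreasing for $i=2N+1$). For $i\in p=\{i,j\}\in P$ put $\iota(i,a)=(j,f(p)+1-a)$ if $s(p)=0$ and $\iota(i,a)=(j,a)$ if $s(p)=1$. An SWB datum $\Theta\in Sq(n,m)$ consists of such $N$, $(P,s,f)$ and a crossingless partition $E$ of $V$ into pairs. Its curve graph has vertex set $V$, the edges in $E$ and the edges $v-\iota(v)$ for $v=(i,a)$, $1\le i\le 2N$. A component $\Gamma$ of the curve graph is *internal* if all its vertices have $1\le i\le 2N$. It is *twisted* if it runs through twisted bands an odd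 number of times. Deleting components, and relabelling the remaining vertices in order, gives new SWB data with the same $(P,s)$; write $\Theta\smallsetminus\Gamma$ for the deletion of $\Gamma$. The component $\Gamma$ is *separating* if, for the datum obtained by deleting all other components, the following graph has two components. Its vertices are the points $(i,a)$ with $a\in\{\tfrac12,\dots,f(p)+\tfrac12\}$, where $i\in p\in\overline P$, and its edges are $v-\iota(v)$ (same formula) for $1\le i\le 2N$, and $u-v$ whenever $\{u,v\}$ crosses no pair of $E$. (Thus $\Gamma$ disconnects the surface.) **Handle slide equivalence** on $Sq(n,m)$ is the equivalence relation generated by the following two moves. * *Pull-throughs.* If $u=(i,a)$ and $v=(i,a+1)$ with $1\le i\le 2N$ are paired in $E$, but $\iota(u),\iota(v)$ are not paired with each other, remove $u,v,\iota(u),\iota(v)$, pair the $E$-partners of $\iota(u)$ and $\iota(v)$ with each other, and relabel in order. * *Handle slides.* Let $\epsilon=\pm1$, $1\le i,\,i+\epsilon\le 2N$, $i\in p\in P$, $i+\epsilon\in q=\{i+\epsilon,i'\}\in P$, $p\ne q$. Let $\sigma$ be the permutation of $\{0,\dots,2N+1\}$ which fixes $0$ and $2N+1$, preserves the order of all elements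 other than $i$, and satisfies $\sigma(i)=\sigma(i')+\epsilon(-1)^{s(q)}$. Replace $P$ by $\sigma(P)$, replace $s(p)$ by $s(p)+s(q)$ and $f(q)$ by $f(q)+f(p)$, and transport $s$ and $f$ along $\sigma$. In the new vertex set $V'$, with new map $\iota'$, let $U$ be the set of $2f(p)$ consecutive vertices which contains all vertices at $\sigma(i)$ and otherwise only vertices at $\sigma(i')$, and let $o:V\to V'\smallsetminus U$ be the order preserving bijection. The new pairing consists of the pairs $o(e)$, $e\in E$, and the pairs $\{\iota'(o(u)),\iota'(o(\iota(u)))\}$ for the vertices $u\in V$ at site $i$. **Morphisms.** For a commutative ring $\mathbb K$ and $\alpha,\beta,\gamma\in\mathbb K$, the module of morphisms $\mathcal{SQ}(n,m)=\mathcal{SQ}(\alpha,\beta,\gamma)(n,m)$ of the square with bands category is the free $\mathbb K$-module on the handle slide equivalence classes in $Sq(n,m)$, modulo the submodule spanned by the elements $[\Theta]-\delta\,[\Theta\smallsetminus\Gamma]$ for $\Theta\in Sq(n,m)$ and $\Gamma$ an internal component of its curve graph, where $\delta=\alpha$ if $\Gamma$ is separating, $\delta=\beta$ if $\Gamma$ is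 twisted, and $\delta=\gamma$ if $\Gamma$ is neither. Let $\overline\Theta\in\mathcal{SQ}(n,m)$ be the image of $[\Theta]$ (a homogeneous morphism). **Proposition.** Let $\Theta\in Sq(n,m)$. There are $a,b,c\in\mathbb N$ and a datum $\Theta'\in Sq(n,m)$ without internal components, independent of $\mathbb K,\alpha,\beta,\gamma$, such that for every commutative ring $\mathbb K$ and all $\alpha,\beta,\gamma\in\mathbb K$ $$\overline\Theta=\alpha^a\beta^b\gamma^c\;\overline{\Theta'}\quad\text{in }\mathcal{SQ}(\alpha,\beta,\gamma)(n,m).$$ The exponents are unique in the following sense: whenever the monomials $\alpha^x\beta^y\gamma^z$ $(x,y,z\in\mathbb N)$ are pairwise distinct elements of $\mathbb K$ (for example if $\alpha,\beta,\gamma$ are independent indeterminates) and $\overline\Theta=\alpha^{a'}\beta^{b'}\gamma^{c'}\;\overline{\Theta''}$ in $\mathcal{SQ}(\alpha,\beta,\gamma)(n,m)$ with $a',b',c'\in\mathbb N$ and $\Theta''\in Sq(n,m)$ without internal components, then $(a',b',c')=(a,b,c)$. -/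

import Mathlib

namespace SWB

/-- A twisted chord datum of rank `N`: a pair-partition `P` of `{1, …, 2N}` with a
twist in `ℤ/2` for every part. The sites `1, …, 2N` are completed by `0` and `2N + 1`, and the
partition `P ∪ {{0}, {2N+1}}` of `{0, …, 2N+1}` is recorded by the involution `mate` sending a
site to the other element of its part. A function on the parts is a function on the sites which is
invariant under `mate`; the twist is set to `0` at the two auxiliary sites. -/
@[ext]
structure TwistedChordDatum (N : ℕ) where
  mate : Fin (2 * N + 2) → Fin (2 * N + 2)
  mate_mate : ∀ i, mate (mate i) = i
  mate_eq_self_iff : ∀ i, mate i = i ↔ i = 0 ∨ i = Fin.last (2 * N + 1)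
  twist : Fin (2 * N + 2) → ZMod 2
  twist_mate : ∀ i, twist (mate i) = twist i
  twist_zero : twist 0 = 0
  twist_last : twist (Fin.last (2 * N + 1)) = 0

/-- The sites `1, …, 2N`, i.e. those other than `0` and `2N + 1`. -/
def IsInner {N : ℕ} (i : Fin (2 * N + 2)) : Prop :=
  i ≠ 0 ∧ i ≠ Fin.last (2 * N + 1)

/-- The boundary graph, on the vertices `(i, ±1)` with `i ∈ {1, …, 2N}`; its edges are
`(i, 1) - (i + 1, -1)`, together with `(i, δ) - (j, -δ)` for an untwisted arc `{i, j}` and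
`(i, δ) - (j, δ)` for a twisted arc `{i, j}`. -/
def TwistedChordDatum.boundaryGraph {N : ℕ} (T : TwistedChordDatum N) :
    SimpleGraph ({i : Fin (2 * N + 2) // IsInner i} × ℤˣ) :=
  SimpleGraph.fromRel fun x y =>
    (x.2 = 1 ∧ y.2 = -1 ∧ (y.1.1 : ℕ) = (x.1.1 : ℕ) + 1) ∨
    (y.1.1 = T.mate x.1.1 ∧ y.2 = if T.twist x.1.1 = 0 then -x.2 else x.2)

/-- `T'` is the chord slide of `T` at the site `i` in the direction `ε`, where `(i, ε)` is
admissible, `k = i + ε`, and `σ` is the associated permutation, extended by fixing `0`, `2N+1`. -/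
structure TwistedChordDatum.IsChordSlide {N : ℕ} (T T' : TwistedChordDatum N)
    (i k : Fin (2 * N + 2)) (ε : ℤˣ) (σ : Equiv.Perm (Fin (2 * N + 2))) : Prop where
  inner_site : IsInner i
  inner_next : IsInner k
  next_eq : ((k : ℕ) : ℤ) = ((i : ℕ) : ℤ) + (ε : ℤ)
  not_mate : T.mate i ≠ k
  perm_zero : σ 0 = 0
  perm_last : σ (Fin.last (2 * N + 1)) = Fin.last (2 * N + 1)
  perm_mono : StrictMonoOn σ {i}ᶜ
  perm_site : ((σ i : ℕ) : ℤ) =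
    ((σ (T.mate k) : ℕ) : ℤ) + (if T.twist k = 0 then (ε : ℤ) else -(ε : ℤ))
  mate_eq : ∀ j, T'.mate (σ j) = σ (T.mate j)
  twist_eq : ∀ j, T'.twist (σ j) = T.twist j + if j = i ∨ j = T.mate i then T.twist k else 0

/-- A frame of rank `N` and type `(n, m)`: a twisted chord datum whose surface has exactly one
boundary component (for `N > 0` this says that the boundary graph has exactly one component; the
rank `0` datum, which is the square, is allowed), and a function `f` on
`P ∪ {{0}, {2N+1}}` with values `n` and `m` at `{0}` and `{2N+1}`. -/
@[ext]
structure Frame (N n m : ℕ) extends TwistedChordDatum N where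
  one_boundary : toTwistedChordDatum.boundaryGraph.Preconnected
  f : Fin (2 * N + 2) → ℕ
  f_mate : ∀ i, f (mate i) = f i
  f_zero : f 0 = n
  f_last : f (Fin.last (2 * N + 1)) = m

/-- The total order on points `(i, a)`: increasing in `i`, then increasing in `a` if `i ≤ 2N` and
decreasing in `a` if `i = 2N + 1`. It is the lexicographic order of `key (i, a)`. -/
def key {N : ℕ} (x : Fin (2 * N + 2) × ℚ) : Fin (2 * N + 2) ×ₗ ℚ :=
  toLex (x.1, if x.1 = Fin.last (2 * N + 1) then -x.2 else x.2)

theorem key_injective {N : ℕ} : Function.Injective (key (N := N)) := by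
  rintro ⟨i, a⟩ ⟨j, b⟩ h
  have h' := congrArg ofLex h
  simp only [key, ofLex_toLex, Prod.mk.injEq] at h'
  obtain ⟨rfl, h2⟩ := h'
  split_ifs at h2 <;> simp_all

/-- The pairs `{x, y}` and `{z, w}` cross. -/
def Crosses {A : Type*} [LinearOrder A] (x y z w : A) : Prop :=
  (min x y < min z w ∧ min z w < max x y ∧ max x y < max z w) ∨
  (min z w < min x y ∧ min x y < max z w ∧ max z w < max x y)

namespace Frame

variable {N n m : ℕ} (F : Frame N n m)

/-- The vertex set of a frame: the points `(i, a)` with `a ∈ {1, …, f i}`. -/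
def Vertex : Type :=
  {x : Fin (2 * N + 2) × ℚ // ∃ a : ℕ, 1 ≤ a ∧ a ≤ F.f x.1 ∧ x.2 = a}

/-- The vertex set of the complement: the points `(i, a)` with `a ∈ {1/2, 3/2, …, f i + 1/2}`. -/
def Gap : Type :=
  {x : Fin (2 * N + 2) × ℚ // ∃ a : ℕ, a ≤ F.f x.1 ∧ x.2 = a + 1 / 2}

noncomputable instance : LinearOrder F.Vertex :=
  LinearOrder.lift' (fun v => key v.1) (key_injective.comp Subtype.val_injective)

/-- The formula for the other end of the strand through a band. It is only used for points on
sites in `{1, …, 2N}`. -/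
def bandPoint (x : Fin (2 * N + 2) × ℚ) : Fin (2 * N + 2) × ℚ :=
  (F.mate x.1, if F.twist x.1 = 0 then (F.f x.1 : ℚ) + 1 - x.2 else x.2)

def bandVertex (v : F.Vertex) : F.Vertex :=
  ⟨F.bandPoint v.1, by
    obtain ⟨⟨i, x⟩, a, h1, h2, h3⟩ := v
    simp only at h2 h3
    simp only [bandPoint, F.f_mate]
    split_ifs
    · refine ⟨F.f i + 1 - a, by omega, by omega, ?_⟩
      rw [Nat.cast_sub (by omega), h3]; push_cast; ring
    · exact ⟨a, h1, h2, h3⟩⟩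

def bandGap (v : F.Gap) : F.Gap :=
  ⟨F.bandPoint v.1, by
    obtain ⟨⟨i, x⟩, a, h2, h3⟩ := v
    simp only at h2 h3
    simp only [bandPoint, F.f_mate]
    split_ifs
    · refine ⟨F.f i - a, by omega, ?_⟩
      rw [Nat.cast_sub (by omega), h3]; ring
    · exact ⟨a, h2, h3⟩⟩

variable {F}

/-- The site `i` of a vertex `(i, a)`. -/
def Vertex.site (v : F.Vertex) : Fin (2 * N + 2) := v.1.1

end Frame

/-- A square with bands datum of rank `N` and type `(n, m)`: a frame with a crossingless
pair-partition of its vertex set, given by the involution `pair` without fixed points. -/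
structure Datum (N n m : ℕ) where
  frame : Frame N n m
  pair : frame.Vertex → frame.Vertex
  pair_pair : ∀ v, pair (pair v) = v
  pair_ne : ∀ v, pair v ≠ v
  crossingless : ∀ u v, ¬ Crosses u (pair u) v (pair v)

namespace Datum

variable {N n m : ℕ} (Θ : Datum N n m)

/-- The curve graph. -/
def curveGraph : SimpleGraph Θ.frame.Vertex :=
  SimpleGraph.fromRel fun u v => v = Θ.pair u ∨ (IsInner u.site ∧ v = Θ.frame.bandVertex u)

/-- The complement graph. -/
def complementGraph : SimpleGraph Θ.frame.Gap :=
  SimpleGraph.fromRel fun u v =>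
    (IsInner u.1.1 ∧ v = Θ.frame.bandGap u) ∨
    ∀ w : Θ.frame.Vertex, ¬ Crosses (key u.1) (key v.1) (key w.1) (key (Θ.pair w).1)

/-- The components of the curve graph. -/
abbrev Component : Type := Θ.curveGraph.ConnectedComponent

variable {Θ}

/-- A component is internal if it has no southern and no northern vertex. -/
def Component.IsInternal (Γ : Θ.Component) : Prop :=
  ∀ v ∈ Γ.supp, IsInner v.site

open Classical in
/-- The twist of a component: the number in `ℤ/2` of its strands through twisted bands. The
strands through the band `{i, j}`, `i < j`, are counted by their ends at the site `i`. -/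
noncomputable def Component.twist (Γ : Θ.Component) : ZMod 2 :=
  ∑ i : Fin (2 * N + 2), if i < Θ.frame.mate i then
    (Set.ncard {v : Θ.frame.Vertex | v ∈ Γ.supp ∧ v.site = i} : ZMod 2) * Θ.frame.twist i else 0

/-- `Θ'` is obtained from `Θ` by keeping only the curves with vertices in `S`, where `S` is a union
of vertex sets of components. The twisted chord datum is unchanged, and vertices are relabelled by
the order preserving bijection. -/
def IsRestriction {n' m' : ℕ} (Θ : Datum N n m) (S : Set Θ.frame.Vertex)
    (Θ' : Datum N n' m') : Prop :=
  Θ'.frame.toTwistedChordDatum = Θ.frame.toTwistedChordDatum ∧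
  (∀ i, Θ'.frame.f i = Set.ncard {v | v ∈ S ∧ v.site = i}) ∧
  ∃ o : S ≃o Θ'.frame.Vertex,
    ∀ x y : S, Θ.pair x = y → Θ'.pair (o x) = o y

/-- `Θ'` is the datum `Θ ∖ Γ` obtained by deleting the component `Γ`. -/
def IsDeletion (Θ : Datum N n m) (Γ : Θ.Component) {n' m' : ℕ} (Θ' : Datum N n' m') : Prop :=
  Θ.IsRestriction (Γ.suppᶜ) Θ'

/-- `Γ` is separating: the complement graph of the datum obtained by deleting all components other
than `Γ` has two components. -/
def Component.IsSeparating (Γ : Θ.Component) : Prop :=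
  ∃ (n' m' : ℕ) (Θ' : Datum N n' m'), Θ.IsRestriction Γ.supp Θ' ∧
    Nat.card Θ'.complementGraph.ConnectedComponent = 2

/-- `Θ'` is obtained from `Θ` by a non-trivial pull-through: `u = (i, a)` and `v = (i, a + 1)` are
paired, while the other ends of their strands through the band at `i` are not paired with each other. These
four vertices are removed, and the vertices that were paired with the other two ends are
paired with each other. -/
def IsPullThrough (Θ Θ' : Datum N n m) : Prop :=
  ∃ u v : Θ.frame.Vertex,
    IsInner u.site ∧ v.site = u.site ∧ v.1.2 = u.1.2 + 1 ∧ Θ.pair u = v ∧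
    Θ.pair (Θ.frame.bandVertex u) ≠ Θ.frame.bandVertex v ∧
    Θ'.frame.toTwistedChordDatum = Θ.frame.toTwistedChordDatum ∧
    (∀ j, Θ.frame.f j =
      Θ'.frame.f j + if j = u.site ∨ j = Θ.frame.mate u.site then 2 else 0) ∧
    ∃ o : ({u, v, Θ.frame.bandVertex u, Θ.frame.bandVertex v}ᶜ : Set Θ.frame.Vertex) ≃o
        Θ'.frame.Vertex,
      ∀ x y : ({u, v, Θ.frame.bandVertex u, Θ.frame.bandVertex v}ᶜ : Set Θ.frame.Vertex),
        (Θ.pair x = y ∨ (x = Θ.pair (Θ.frame.bandVertex u) ∧ y = Θ.pair (Θ.frame.bandVertex v))) →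
        Θ'.pair (o x) = o y

/-- `Θ'` is the handle slide of `Θ` at an admissible pair `(i, ε)`, with `k = i + ε`. The
strands in the band at `i` are continued through the band at `k`; `U` consists of the
new vertices, and `o` is the order preserving bijection from the old vertices to the others. A
strand from `x` to its other end `y` in the band at `i` becomes the path which runs from `o x`
through the band at `k`, inside the square along an edge with ends in `U`,
and through the moved band to `o y`. -/
def IsHandleSlide (Θ Θ' : Datum N n m) : Prop :=
  ∃ (i k : Fin (2 * N + 2)) (ε : ℤˣ) (σ : Equiv.Perm (Fin (2 * N + 2))),
    Θ.frame.toTwistedChordDatum.IsChordSlide Θ'.frame.toTwistedChordDatum i k ε σ ∧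
    (∀ j, Θ'.frame.f (σ j) =
      Θ.frame.f j + if j = k ∨ j = Θ.frame.mate k then Θ.frame.f i else 0) ∧
    ∃ (U : Set Θ'.frame.Vertex) (o : Θ.frame.Vertex ↪o Θ'.frame.Vertex),
      U.OrdConnected ∧ U.ncard = 2 * Θ.frame.f i ∧
      {v | v.site = σ i} ⊆ U ∧ U ⊆ {v | v.site = σ i ∨ v.site = σ (Θ.frame.mate k)} ∧
      Set.range o = Uᶜ ∧
      (∀ x, Θ'.pair (o x) = o (Θ.pair x)) ∧
      ∀ x, x.site = i → Θ'.pair (Θ'.frame.bandVertex (o x)) =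
        Θ'.frame.bandVertex (o (Θ.frame.bandVertex x))

end Datum

/-- The set of square with bands data of type `(n, m)` and of any rank. -/
def Sq (n m : ℕ) : Type := Σ N : ℕ, Datum N n m

/-- The curve graph has no internal components. -/
def Sq.WithoutInternal {n m : ℕ} (Θ : Sq n m) : Prop :=
  ∀ Γ : Θ.2.Component, ¬ Γ.IsInternal

/-- Isotopy: the equivalence relation generated by pull-throughs. -/
def Isotopic {n m : ℕ} : Sq n m → Sq n m → Prop :=
  Relation.EqvGen fun x y => ∃ (N : ℕ) (Θ Θ' : Datum N n m),
    x = ⟨N, Θ⟩ ∧ y = ⟨N, Θ'⟩ ∧ Θ.IsPullThrough Θ'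

/-- Handle slide equivalence: the equivalence relation generated by isotopies and handle slides. -/
def handleSlideSetoid (n m : ℕ) : Setoid (Sq n m) :=
  Relation.EqvGen.setoid fun x y => Isotopic x y ∨ ∃ (N : ℕ) (Θ Θ' : Datum N n m),
    x = ⟨N, Θ⟩ ∧ y = ⟨N, Θ'⟩ ∧ Θ.IsHandleSlide Θ'

/-- The set of handle slide equivalence classes. -/
def SqHS (n m : ℕ) : Type := Quotient (handleSlideSetoid n m)

section Morphisms

variable (K : Type*) [CommRing K]

/-- The basis element of the free module on `SqHS n m` given by the class of `Θ`. -/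
noncomputable def basisClass {n m : ℕ} (Θ : Sq n m) : SqHS n m →₀ K :=
  Finsupp.single (Quotient.mk (handleSlideSetoid n m) Θ) 1

variable {K}

/-- Deleting an internal separating component costs a factor `α`. -/
noncomputable def relationsA (α : K) (n m : ℕ) : Submodule K (SqHS n m →₀ K) :=
  Submodule.span K {x | ∃ (N : ℕ) (Θ Θ' : Datum N n m) (Γ : Θ.Component),
    Γ.IsInternal ∧ Γ.IsSeparating ∧ Θ.IsDeletion Γ Θ' ∧
    x = basisClass K ⟨N, Θ⟩ - α • basisClass K ⟨N, Θ'⟩}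

/-- Deleting an internal twisted component costs a factor `β`. -/
noncomputable def relationsB (β : K) (n m : ℕ) : Submodule K (SqHS n m →₀ K) :=
  Submodule.span K {x | ∃ (N : ℕ) (Θ Θ' : Datum N n m) (Γ : Θ.Component),
    Γ.IsInternal ∧ Γ.twist = 1 ∧ Θ.IsDeletion Γ Θ' ∧
    x = basisClass K ⟨N, Θ⟩ - β • basisClass K ⟨N, Θ'⟩}

/-- Deleting an internal, non-separating, untwisted component costs a factor `γ`. -/
noncomputable def relationsC (γ : K) (n m : ℕ) : Submodule K (SqHS n m →₀ K) :=
  Submodule.span K {x | ∃ (N : ℕ) (Θ Θ' : Datum N n m) (Γ : Θ.Component),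
    Γ.IsInternal ∧ ¬ Γ.IsSeparating ∧ Γ.twist = 0 ∧ Θ.IsDeletion Γ Θ' ∧
    x = basisClass K ⟨N, Θ⟩ - γ • basisClass K ⟨N, Θ'⟩}

/-- The module of morphisms from `n` to `m` in the square with bands category with parameters
`α`, `β`, `γ`. -/
abbrev SQ (α β γ : K) (n m : ℕ) : Type _ :=
  (SqHS n m →₀ K) ⧸ (relationsA α n m ⊔ relationsB β n m ⊔ relationsC γ n m)

/-- The homogeneous morphism of a square with bands datum. -/
noncomputable def hom (α β γ : K) {n m : ℕ} (Θ : Sq n m) : SQ α β γ n m :=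
  Submodule.Quotient.mk (basisClass K Θ)

end Morphisms

end SWB

/-! Existence is repeated deletion. An internal component can be removed at the price of one factor
`α`, `β` or `γ`, and each removal lowers the number of vertices. Which parameter appears depends
only on the curve, so the exponents serve all rings at once (`exists_hom_eq_monomial_smul`).

Uniqueness needs an invariant: the `weight`, the product of the factors of all internal components.
Once it is known to survive pull-throughs and handle slides and to be multiplicative under deletion,
it induces a linear form `morphismWeight` on the module of morphisms. This form is `1` on data
without internal components, so applying it to two expressions for the same morphism identifies
their monomials.

The obstacle is that being separating is defined by the complement graph, which is hard to follow
through the moves. Since the surface has one boundary component, it can be replaced by arithmetic: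
an internal component separates if and only if it meets every band an even number of times
(`Component.isSeparating_iff`). If all counts are even, counting the preceding vertices modulo 2 is
a chessboard colouring of the gaps. Conversely, the colouring by the two sides of a separating curve
is constant along the boundary of the surface, hence agrees on both edges of a band, while it
changes at every strand between them.

The factor thus depends only on being internal, on the parities of `siteCount`, and on the twist. A
pull-through removes two strands of one component from one band (`weight_of_isPullThrough`). A
handle slide adds the count of one band to that of another, which is invertible modulo 2, and
changes the twist by the same term twice (`IsSlideMap.weight_eq`). Both moves match the components
of the two curve graphs. -/

namespace SWB

/-! ### Rigidity of finite linear orders, crossings and parity -/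

/-- Two monotone maps on a finite linear order with fibres of the same size are equal. -/
theorem eq_of_monotone_of_ncard_fiber_eq {A L : Type*} [LinearOrder A] [Finite A] [LinearOrder L]
    {p q : A → L} (hp : Monotone p) (hq : Monotone q)
    (h : ∀ l, {a | p a = l}.ncard = {a | q a = l}.ncard) : p = q := by
  -- Gluing bijections of fibres gives a permutation carrying `{p < p x}` onto `{q < p x}`. If `q x
  -- < p x`, monotonicity makes the first set a proper subset of the second, since only the second
  -- contains `x`.
  have key : ∀ {p q : A → L}, Monotone p → Monotone q →
      (∀ l, {a | p a = l}.ncard = {a | q a = l}.ncard) → ∀ x, ¬ q x < p x := by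
    intro p q hp hq h x hx
    have e : ∀ l, Nonempty ({a // p a = l} ≃ {a // q a = l}) := fun l =>
      (Finite.card_eq (α := {a // p a = l})).1 (h l)
    let e' : A ≃ A := Equiv.ofFiberEquiv (f := p) (g := q) fun l => (e l).some
    have he : ∀ a, q (e' a) = p a := Equiv.ofFiberEquiv_map _
    have himg : e' '' {a | p a < p x} = {a | q a < p x} := by
      ext b
      constructor
      · rintro ⟨a, ha, rfl⟩
        simpa [he] using ha
      · intro hb
        refine ⟨e'.symm b, ?_, by simp⟩
        have := he (e'.symm b)
        simp only [Equiv.apply_symm_apply] at this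
        simpa [← this] using hb
    have hc : {a | p a < p x}.ncard = {a | q a < p x}.ncard := by
      rw [← himg, Set.ncard_image_of_injective _ e'.injective]
    have hss : {a | p a < p x} ⊂ {a | q a < p x} := by
      refine ⟨fun a ha => ?_, fun hs => lt_irrefl _ (hs hx)⟩
      have hax : a ≤ x := by
        by_contra hn
        exact absurd (hp (not_le.1 hn).le) (not_le.2 ha)
      exact lt_of_le_of_lt (hq hax) hx
    exact absurd hc (Set.ncard_lt_ncard hss (Set.toFinite _)).ne
  funext x
  exact le_antisymm (not_lt.1 (key hp hq h x)) (not_lt.1 (key hq hp (fun l => (h l).symm) x))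

/-- Two maps which are strictly monotone on a finite set, with values of the one among the values
of the other, agree on it. -/
theorem eqOn_of_strictMonoOn {A B : Type*} [LinearOrder A] [Finite A] [LinearOrder B]
    {X : Set A} {g h : A → B} (hg : StrictMonoOn g X) (hh : StrictMonoOn h X)
    (hgh : ∀ x ∈ X, h x ∈ g '' X) : Set.EqOn h g X := by
  have himg : h '' X = g '' X := by
    refine Set.eq_of_subset_of_ncard_le ?_ ?_ (Set.toFinite _)
    · rintro _ ⟨x, hx, rfl⟩
      exact hgh x hx
    · rw [hg.injOn.ncard_image, hh.injOn.ncard_image]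
  intro x
  -- At a least point of disagreement, the smaller of the two values is attained by the other map at
  -- an earlier point, where both maps already agree; this contradicts injectivity.
  induction x using WellFoundedLT.induction with
  | ind x ih =>
    intro hx
    rcases lt_trichotomy (h x) (g x) with hlt | heq | hlt
    · obtain ⟨y, hy, hyx⟩ := hgh x hx
      have hlt' : y < x := (hg.lt_iff_lt hy hx).1 (hyx ▸ hlt)
      have := ih y hlt' hy
      exact absurd (hh.injOn hy hx (this.trans hyx)) hlt'.ne
    · exact heq
    · obtain ⟨y, hy, hyx⟩ : g x ∈ h '' X := himg ▸ ⟨x, hx, rfl⟩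
      have hlt' : y < x := (hh.lt_iff_lt hy hx).1 (hyx ▸ hlt)
      have := ih y hlt' hy
      exact absurd (hg.injOn hy hx (this.symm.trans hyx)) hlt'.ne

theorem eqOn_of_strictAntiOn {A B : Type*} [LinearOrder A] [Finite A] [LinearOrder B]
    {X : Set A} {g h : A → B} (hg : StrictAntiOn g X) (hh : StrictAntiOn h X)
    (hgh : ∀ x ∈ X, h x ∈ g '' X) : Set.EqOn h g X :=
  eqOn_of_strictMonoOn (B := Bᵒᵈ) hg.dual_right hh.dual_right hgh

theorem crosses_map_iff {A B : Type*} [LinearOrder A] [LinearOrder B] {g : A → B}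
    (hg : StrictMono g) (x y z w : A) :
    Crosses (g x) (g y) (g z) (g w) ↔ Crosses x y z w := by
  simp only [Crosses, ← hg.monotone.map_min, ← hg.monotone.map_max, hg.lt_iff_lt]

/-- Two pairs without common elements cross if and only if exactly one element of the second pair
lies between the elements of the first. -/
theorem crosses_iff {A : Type*} [LinearOrder A] {x y z w : A} (hzx : z ≠ x) (hzy : z ≠ y)
    (hwx : w ≠ x) (hwy : w ≠ y) :
    Crosses x y z w ↔ ¬ ((min x y < z ∧ z < max x y) ↔ (min x y < w ∧ w < max x y)) := by
  unfold Crosses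
  rcases le_total x y with h1 | h1 <;> rcases le_total z w with h2 | h2 <;>
    simp only [min_eq_left, min_eq_right, max_eq_left, max_eq_right, h1, h2] <;> grind

theorem even_ncard_of_involution {A : Type*} [Finite A] {s : Set A} {g : A → A}
    (hgg : ∀ x, g (g x) = x) (hne : ∀ x, g x ≠ x) (hs : ∀ x ∈ s, g x ∈ s) : Even s.ncard := by
  classical
  have := Fintype.ofFinite A
  have h : ∑ _x ∈ s.toFinset, (1 : ZMod 2) = 0 :=
    Finset.sum_involution (fun x _ => g x) (fun _ _ => by decide) (fun x _ _ => hne x)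
      (fun x hx => by simpa using hs x (by simpa using hx)) (fun x _ => hgg x)
  rw [Finset.sum_const, nsmul_eq_mul, mul_one, ZMod.natCast_eq_zero_iff_even] at h
  rwa [Set.ncard_eq_toFinset_card']

/-! ### Sites, vertices and the passage through a band -/

namespace TwistedChordDatum

variable {N : ℕ} (T : TwistedChordDatum N)

theorem mate_injective : Function.Injective T.mate :=
  Function.LeftInverse.injective T.mate_mate

theorem isInner_iff_mate_ne (i : Fin (2 * N + 2)) : IsInner i ↔ T.mate i ≠ i := by
  rw [Ne, T.mate_eq_self_iff, IsInner, not_or]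

theorem isInner_mate_iff (i : Fin (2 * N + 2)) : IsInner (T.mate i) ↔ IsInner i := by
  rw [T.isInner_iff_mate_ne, T.isInner_iff_mate_ne, T.mate_mate, ne_comm]

end TwistedChordDatum

namespace Frame

variable {N n m : ℕ} {F : Frame N n m}

/-- The vertex `(j, a + 1)`. -/
def ofIndex (F : Frame N n m) (x : Σ j, Fin (F.f j)) : F.Vertex :=
  ⟨(x.1, ((x.2 : ℕ) + 1 : ℕ)), x.2 + 1, by omega, by have := x.2.2; simp only; omega, rfl⟩

theorem ofIndex_bijective (F : Frame N n m) : Function.Bijective F.ofIndex := by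
  constructor
  · rintro ⟨j, a⟩ ⟨k, b⟩ h
    have h' := congrArg Subtype.val h
    simp only [ofIndex, Prod.mk.injEq, Nat.cast_inj] at h'
    obtain ⟨rfl, h2⟩ := h'
    simp only [Sigma.mk.injEq, heq_eq_eq, true_and]
    exact Fin.ext (by omega)
  · rintro ⟨⟨j, x⟩, a, h1, h2, h3⟩
    simp only at h2 h3
    subst h3
    refine ⟨⟨j, a - 1, by omega⟩, Subtype.ext ?_⟩
    simp only [ofIndex]
    rw [Nat.sub_add_cancel h1]

instance : Finite F.Vertex := Finite.of_surjective _ F.ofIndex_bijective.2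

theorem ncard_site (F : Frame N n m) (j : Fin (2 * N + 2)) :
    {v : F.Vertex | v.site = j}.ncard = F.f j := by
  have h : {v : F.Vertex | v.site = j} = Set.range fun a : Fin (F.f j) => F.ofIndex ⟨j, a⟩ := by
    ext v
    constructor
    · obtain ⟨⟨k, a⟩, rfl⟩ := F.ofIndex_bijective.2 v
      rintro rfl
      exact ⟨a, rfl⟩
    · rintro ⟨a, rfl⟩
      rfl
  rw [h, ← Nat.card_coe_set_eq, Nat.card_range_of_injective, Nat.card_fin]
  intro a b hab
  simpa using F.ofIndex_bijective.1 hab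

theorem Vertex.lt_iff {v w : F.Vertex} : v < w ↔ key v.1 < key w.1 := Iff.rfl

theorem key_lt_key_iff {x y : Fin (2 * N + 2) × ℚ} (hx : x.1 ≠ Fin.last (2 * N + 1)) :
    key x < key y ↔ x.1 < y.1 ∨ x.1 = y.1 ∧ x.2 < y.2 := by
  rw [key, key, Prod.Lex.toLex_lt_toLex, if_neg hx]
  refine or_congr_right (and_congr_right fun h => ?_)
  simp only at h
  rw [if_neg (h ▸ hx)]

theorem site_monotone : Monotone (Vertex.site (F := F)) := by
  intro v w h
  rcases h.lt_or_eq with h | rfl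
  · rw [Vertex.lt_iff, key, key, Prod.Lex.toLex_lt_toLex] at h
    rcases h with h | h
    · exact h.le
    · exact h.1.le
  · rfl

theorem Vertex.lt_iff_of_site_eq {v w : F.Vertex} (hv : IsInner v.site) (h : v.site = w.site) :
    v < w ↔ v.1.2 < w.1.2 := by
  rw [Vertex.lt_iff, key_lt_key_iff hv.2]
  have : v.1.1 = w.1.1 := h
  simp [this]

theorem bandPoint_bandPoint (F : Frame N n m) (x : Fin (2 * N + 2) × ℚ) :
    F.bandPoint (F.bandPoint x) = x := by
  simp only [bandPoint, F.mate_mate, F.twist_mate, F.f_mate]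
  ext
  · rfl
  · simp only
    split_ifs <;> ring

@[simp]
theorem bandVertex_bandVertex (v : F.Vertex) : F.bandVertex (F.bandVertex v) = v :=
  Subtype.ext (F.bandPoint_bandPoint v.1)

theorem bandVertex_injective : Function.Injective F.bandVertex :=
  Function.LeftInverse.injective bandVertex_bandVertex

@[simp]
theorem site_bandVertex (v : F.Vertex) : (F.bandVertex v).site = F.mate v.site := rfl

theorem bandVertex_strictMonoOn {j : Fin (2 * N + 2)} (hj : IsInner j) (ht : F.twist j ≠ 0) :
    StrictMonoOn F.bandVertex {v | v.site = j} := by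
  rintro v rfl w hw hvw
  replace hw : w.site = v.site := hw
  rw [Vertex.lt_iff_of_site_eq hj hw.symm] at hvw
  rw [Vertex.lt_iff_of_site_eq (v := F.bandVertex v) (w := F.bandVertex w)
    ((F.isInner_mate_iff _).2 hj) (congrArg F.mate hw.symm)]
  change (if F.twist v.site = 0 then _ else v.1.2) < (if F.twist w.site = 0 then _ else w.1.2)
  rw [hw, if_neg ht, if_neg ht]
  exact hvw

theorem bandVertex_strictAntiOn {j : Fin (2 * N + 2)} (hj : IsInner j) (ht : F.twist j = 0) :
    StrictAntiOn F.bandVertex {v | v.site = j} := by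
  rintro v rfl w hw hvw
  replace hw : w.site = v.site := hw
  rw [Vertex.lt_iff_of_site_eq hj hw.symm] at hvw
  rw [Vertex.lt_iff_of_site_eq (v := F.bandVertex w) (w := F.bandVertex v)
    ((F.isInner_mate_iff w.site).2 (by rwa [hw])) (congrArg F.mate hw)]
  change (if F.twist w.site = 0 then (F.f w.site : ℚ) + 1 - w.1.2 else w.1.2) <
    (if F.twist v.site = 0 then (F.f v.site : ℚ) + 1 - v.1.2 else v.1.2)
  rw [hw, if_pos ht, if_pos ht]
  linarith

/-- A strictly increasing relabelling which maps the ends of strands at a site of one frame to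
those at a site of another frame with the same twist commutes with the passage through the bands,
as soon as the latter preserves the set of relabelled ends. -/
theorem bandVertex_comm {n' m' : ℕ} {F' : Frame N n' m'} {A : Type*} [LinearOrder A] [Finite A]
    {r : A → F.Vertex} {o : A → F'.Vertex} {τ : A → A} (hr : StrictMono r) (ho : StrictMono o)
    (hτ : ∀ x, IsInner (r x).site → r (τ x) = F.bandVertex (r x))
    {j j' : Fin (2 * N + 2)} (hj : IsInner j) (hj' : IsInner j')
    (ht : F'.twist j' = F.twist j) (hs : ∀ x, (r x).site = j → (o x).site = j')
    (h : ∀ x, (r x).site = j → ∃ y, (r y).site = j ∧ F'.bandVertex (o x) = o (τ y))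
    {x : A} (hx : (r x).site = j) : F'.bandVertex (o x) = o (τ x) := by
  set X : Set A := {x | (r x).site = j}
  have himg : ∀ x ∈ X, (F'.bandVertex ∘ o) x ∈ (o ∘ τ) '' X := fun x hx => by
    obtain ⟨y, hy, hxy⟩ := h x hx
    exact ⟨y, hy, hxy.symm⟩
  have hlt : ∀ {x y}, x ∈ X → y ∈ X → (τ x < τ y ↔ F.bandVertex (r x) < F.bandVertex (r y)) := by
    intro x y hx hy
    rw [← hτ x (hx ▸ hj), ← hτ y (hy ▸ hj), hr.lt_iff_lt]
  -- The passage reverses the order in an untwisted band and preserves it in a twisted one. In both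
  -- cases the two maps are monotone in the same sense with comparable images, so rigidity applies.
  by_cases h0 : F.twist j = 0
  · refine eqOn_of_strictAntiOn (X := X) (g := o ∘ τ) (h := F'.bandVertex ∘ o)
      (fun a ha b hb hab => ho ?_) (fun a ha b hb hab => ?_) himg hx
    · rw [hlt hb ha]
      exact bandVertex_strictAntiOn hj h0 ha hb (hr hab)
    · exact bandVertex_strictAntiOn hj' (ht.trans h0) (hs a ha) (hs b hb) (ho hab)
  · refine eqOn_of_strictMonoOn (X := X) (g := o ∘ τ) (h := F'.bandVertex ∘ o)
      (fun a ha b hb hab => ho ?_) (fun a ha b hb hab => ?_) himg hx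
    · rw [hlt ha hb]
      exact bandVertex_strictMonoOn hj h0 ha hb (hr hab)
    · exact bandVertex_strictMonoOn hj' (ht ▸ h0) (hs a ha) (hs b hb) (ho hab)

end Frame

end SWB

/-! ### Relabelling the vertices of a union of components -/

namespace SWB

namespace Frame

variable {N n m n' m' : ℕ} {F : Frame N n m} {F' : Frame N n' m'} {W : Set F.Vertex}

theorem ncard_subtype_site (W : Set F.Vertex) (j : Fin (2 * N + 2)) :
    {x : W | x.1.site = j}.ncard = {v | v ∈ W ∧ v.site = j}.ncard := by
  rw [← Set.ncard_image_of_injective _ Subtype.val_injective]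
  congr 1
  ext v
  simp [and_comm]

/-- The relabelling is only required to preserve the order. Its effect on sites is forced, because
both site maps are monotone and have fibres of the same sizes. -/
theorem site_orderIso (o : W ≃o F'.Vertex)
    (hf : ∀ j, F'.f j = {v | v ∈ W ∧ v.site = j}.ncard) (x : W) : (o x).site = x.1.site := by
  have h : (fun x : W => (o x).site) = fun x => x.1.site := by
    refine eq_of_monotone_of_ncard_fiber_eq (site_monotone.comp o.monotone)
      (site_monotone.comp (Subtype.mono_coe _)) fun l => ?_
    have h1 : o '' {a | (o a).site = l} = {v | v.site = l} :=
      Set.image_preimage_eq {v : F'.Vertex | v.site = l} o.surjective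
    rw [← Set.ncard_image_of_injective _ o.injective, h1, ncard_site, hf]
    exact (ncard_subtype_site W l).symm
  exact congrFun h x

theorem bandVertex_orderIso (o : W ≃o F'.Vertex)
    (hT : F'.toTwistedChordDatum = F.toTwistedChordDatum)
    (hf : ∀ j, F'.f j = {v | v ∈ W ∧ v.site = j}.ncard)
    (hW : ∀ v ∈ W, IsInner v.site → F.bandVertex v ∈ W) (x : W) (hx : IsInner x.1.site) :
    F'.bandVertex (o x) = o ⟨F.bandVertex x, hW x x.2 hx⟩ := by
  classical
  have hm : F'.mate = F.mate := congrArg TwistedChordDatum.mate hT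
  have ht : F'.twist = F.twist := congrArg TwistedChordDatum.twist hT
  have hs := site_orderIso o hf
  -- The band involution restricts to `W` only at inner sites; elsewhere it is replaced by the
  -- identity to get a total map.
  let τ : W → W := fun x => if h : IsInner x.1.site then ⟨F.bandVertex x, hW x x.2 h⟩ else x
  have hτ : ∀ (x : W) (h : IsInner x.1.site), τ x = ⟨F.bandVertex x, hW x x.2 h⟩ := fun x h =>
    dif_pos h
  rw [← hτ x hx]
  refine bandVertex_comm (r := Subtype.val) (o := o) (τ := τ) (j := x.1.site) (j' := x.1.site)
    (Subtype.strictMono_coe _) o.strictMono (fun x hx => by rw [hτ x hx]) hx hx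
    (congrFun ht _) (fun y hy => (hs y).trans hy) (fun y hy => ?_) rfl
  obtain ⟨w, hw⟩ := o.surjective (F'.bandVertex (o y))
  have hws : w.1.site = F.mate x.1.site := by
    rw [← hs, hw, site_bandVertex, hs, hy, hm]
  have hwi : IsInner w.1.site := by
    rw [hws, F.isInner_mate_iff]
    exact hx
  refine ⟨τ w, ?_, ?_⟩
  · rw [hτ w hwi]
    exact (congrArg F.mate hws).trans (F.mate_mate _)
  · have hi : IsInner (τ w).1.site := by
      rw [hτ w hwi]
      exact (F.isInner_mate_iff _).2 hwi
    rw [hτ _ hi, ← hw]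
    congr 1
    refine Subtype.ext ?_
    simp only [hτ w hwi, bandVertex_bandVertex]

end Frame

/-! ### Components of the curve graph and existence of restrictions -/

namespace Datum

variable {N n m n' m' : ℕ} {Θ : Datum N n m} {Θ' : Datum N n' m'}

/-- A union of components of the curve graph, as a predicate on vertices. -/
def IsInvariant (Θ : Datum N n m) (c : Θ.frame.Vertex → Prop) : Prop :=
  (∀ u, c u → c (Θ.pair u)) ∧ ∀ u, IsInner u.site → c u → c (Θ.frame.bandVertex u)

theorem reachable_pair (u : Θ.frame.Vertex) : Θ.curveGraph.Reachable u (Θ.pair u) :=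
  SimpleGraph.Adj.reachable ((SimpleGraph.fromRel_adj _ _ _).2
    ⟨(Θ.pair_ne u).symm, Or.inl (Or.inl rfl)⟩)

theorem reachable_bandVertex {u : Θ.frame.Vertex} (hu : IsInner u.site) :
    Θ.curveGraph.Reachable u (Θ.frame.bandVertex u) := by
  by_cases h : u = Θ.frame.bandVertex u
  · rw [← h]
  · exact SimpleGraph.Adj.reachable ((SimpleGraph.fromRel_adj _ _ _).2
      ⟨h, Or.inl (Or.inr ⟨hu, rfl⟩)⟩)

/-- The component of `x` is the smallest invariant set containing `x`. Connectivity is compared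
between data by transporting invariant predicates instead of walks. -/
theorem reachable_iff {x y : Θ.frame.Vertex} :
    Θ.curveGraph.Reachable x y ↔ ∀ c, Θ.IsInvariant c → c x → c y := by
  constructor
  · rintro ⟨p⟩ c hc hx
    induction p with
    | nil => exact hx
    | cons h p ih =>
      refine ih ?_
      rcases ((SimpleGraph.fromRel_adj _ _ _).1 h).2 with (h | ⟨h1, h⟩) | (h | ⟨h1, h⟩)
      · exact h ▸ hc.1 _ hx
      · exact h ▸ hc.2 _ h1 hx
      · rw [h] at hx
        simpa [Θ.pair_pair] using hc.1 _ hx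
      · rw [h] at hx
        simpa using hc.2 (Θ.frame.bandVertex _) ((Θ.frame.isInner_mate_iff _).2 h1) hx
  · intro h
    exact h (Θ.curveGraph.Reachable x)
      ⟨fun u hu => hu.trans (reachable_pair u), fun u hi hu => hu.trans (reachable_bandVertex hi)⟩
      (SimpleGraph.Reachable.refl x)

/-- The component of a vertex. -/
def componentOf (Θ : Datum N n m) (v : Θ.frame.Vertex) : Θ.Component :=
  Θ.curveGraph.connectedComponentMk v

theorem componentOf_eq_iff {x y : Θ.frame.Vertex} :
    Θ.componentOf x = Θ.componentOf y ↔ Θ.curveGraph.Reachable x y :=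
  SimpleGraph.ConnectedComponent.eq

theorem mem_supp_iff {Γ : Θ.Component} {v : Θ.frame.Vertex} :
    v ∈ Γ.supp ↔ Θ.componentOf v = Γ := Iff.rfl

theorem exists_componentOf (Γ : Θ.Component) : ∃ v, Θ.componentOf v = Γ :=
  Γ.exists_rep

theorem isInvariant_supp (Γ : Θ.Component) : Θ.IsInvariant (· ∈ Γ.supp) :=
  ⟨fun u hu => (componentOf_eq_iff.2 (reachable_pair u).symm).trans hu,
    fun _ hi hu => (componentOf_eq_iff.2 (reachable_bandVertex hi).symm).trans hu⟩

theorem pair_mem_supp_iff {Γ : Θ.Component} {v : Θ.frame.Vertex} :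
    Θ.pair v ∈ Γ.supp ↔ v ∈ Γ.supp :=
  ⟨fun h => Θ.pair_pair v ▸ (isInvariant_supp Γ).1 _ h, (isInvariant_supp Γ).1 v⟩

theorem bandVertex_mem_supp_iff {Γ : Θ.Component} {v : Θ.frame.Vertex} (hv : IsInner v.site) :
    Θ.frame.bandVertex v ∈ Γ.supp ↔ v ∈ Γ.supp := by
  refine ⟨fun h => ?_, (isInvariant_supp Γ).2 v hv⟩
  simpa using (isInvariant_supp Γ).2 (Θ.frame.bandVertex v) ((Θ.frame.isInner_mate_iff _).2 hv) h

theorem isInvariant_compl_supp (Γ : Θ.Component) : Θ.IsInvariant (· ∈ Γ.suppᶜ) :=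
  ⟨fun _ hu h => hu (pair_mem_supp_iff.1 h), fun _ hi hu h => hu ((bandVertex_mem_supp_iff hi).1 h)⟩

instance : Finite Θ.Component :=
  Finite.of_surjective Θ.componentOf exists_componentOf

/-- The number of vertices of a component at a site. -/
noncomputable def Component.siteCount (Γ : Θ.Component) (j : Fin (2 * N + 2)) : ℕ :=
  {v | v ∈ Γ.supp ∧ v.site = j}.ncard

theorem Component.siteCount_mate (Γ : Θ.Component) (j : Fin (2 * N + 2)) :
    Γ.siteCount (Θ.frame.mate j) = Γ.siteCount j := by
  by_cases hj : IsInner j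
  · have h : {v | v ∈ Γ.supp ∧ v.site = Θ.frame.mate j} =
        Θ.frame.bandVertex '' {v | v ∈ Γ.supp ∧ v.site = j} := by
      ext v
      constructor
      · rintro ⟨hv, hs⟩
        have hi : IsInner v.site := hs ▸ (Θ.frame.isInner_mate_iff _).2 hj
        exact ⟨Θ.frame.bandVertex v, ⟨(bandVertex_mem_supp_iff hi).2 hv, by
          rw [Frame.site_bandVertex, hs, Θ.frame.mate_mate]⟩, by simp⟩
      · rintro ⟨w, ⟨hw, rfl⟩, rfl⟩
        exact ⟨(bandVertex_mem_supp_iff hj).2 hw, rfl⟩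
    rw [siteCount, h, Set.ncard_image_of_injective _ Frame.bandVertex_injective, siteCount]
  · rw [Θ.frame.isInner_iff_mate_ne, not_not] at hj
    rw [hj]

theorem Component.isInternal_iff (Γ : Θ.Component) :
    Γ.IsInternal ↔ Γ.siteCount 0 = 0 ∧ Γ.siteCount (Fin.last _) = 0 := by
  simp only [siteCount, Set.ncard_eq_zero (Set.toFinite _), Set.eq_empty_iff_forall_notMem,
    Set.mem_ofPred_eq, not_and, ← forall_and, IsInternal, IsInner]

/-- The restriction of a datum to a union of components exists. -/
theorem exists_isRestriction {S : Set Θ.frame.Vertex} (hS : Θ.IsInvariant (· ∈ S))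
    (h0 : n' = {v | v ∈ S ∧ v.site = 0}.ncard)
    (hl : m' = {v | v ∈ S ∧ v.site = Fin.last _}.ncard) :
    ∃ Θ' : Datum N n' m', Θ.IsRestriction S Θ' := by
  classical
  let f : Fin (2 * N + 2) → ℕ := fun j => {v | v ∈ S ∧ v.site = j}.ncard
  -- One inequality suffices: at `mate j` it becomes the reverse one.
  have hle : ∀ j, f (Θ.frame.mate j) ≤ f j := by
    intro j
    by_cases hj : IsInner j
    · refine Set.ncard_le_ncard_of_injOn Θ.frame.bandVertex ?_
        (Frame.bandVertex_injective.injOn) (Set.toFinite _)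
      rintro v ⟨hv, hs⟩
      have hi : IsInner v.site := hs ▸ (Θ.frame.isInner_mate_iff _).2 hj
      exact ⟨hS.2 v hi hv, by rw [Frame.site_bandVertex, hs, Θ.frame.mate_mate]⟩
    · rw [Θ.frame.isInner_iff_mate_ne, not_not] at hj
      rw [hj]
  let F' : Frame N n' m' :=
    { Θ.frame.toTwistedChordDatum with
      one_boundary := Θ.frame.one_boundary
      f := f
      f_mate := fun j => (hle j).antisymm (by simpa [Θ.frame.mate_mate] using hle (Θ.frame.mate j))
      f_zero := h0.symm
      f_last := hl.symm }
  have hcard : Nat.card S = Nat.card F'.Vertex := by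
    have e : ∀ j, Nonempty ({x : S // x.1.site = j} ≃ {v : F'.Vertex // v.site = j}) := by
      intro j
      refine (Finite.card_eq).1 ?_
      have h1 : Nat.card {v : F'.Vertex // v.site = j} = f j := F'.ncard_site j
      rw [h1]
      exact Frame.ncard_subtype_site S j
    exact Nat.card_congr (Equiv.ofFiberEquiv fun j => (e j).some)
  have := Fintype.ofFinite S
  have := Fintype.ofFinite F'.Vertex
  -- Both orders are finite of the same size, so both are enumerated by the same `Fin`.
  let o : S ≃o F'.Vertex :=
    (Fintype.orderIsoFinOfCardEq S Nat.card_eq_fintype_card.symm).symm.trans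
      (Fintype.orderIsoFinOfCardEq F'.Vertex (Nat.card_eq_fintype_card.symm.trans hcard.symm))
  let π : S → S := fun x => ⟨Θ.pair x, hS.1 x x.2⟩
  refine ⟨⟨F', fun v => o (π (o.symm v)), fun v => ?_, fun v h => ?_, fun v w => ?_⟩,
    rfl, fun _ => rfl, o, fun x y hxy => ?_⟩
  · simp [π, Θ.pair_pair]
  · have h1 : π (o.symm v) = o.symm v := o.injective (by simpa using h)
    exact Θ.pair_ne _ (congrArg Subtype.val h1)
  · obtain ⟨x, rfl⟩ := o.surjective v
    obtain ⟨y, rfl⟩ := o.surjective w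
    simp only [OrderIso.symm_apply_apply]
    rw [crosses_map_iff o.strictMono, ← crosses_map_iff (Subtype.strictMono_coe (· ∈ S))]
    exact Θ.crossingless _ _
  · change o (π (o.symm (o x))) = o y
    rw [OrderIso.symm_apply_apply]
    exact congrArg o (Subtype.ext hxy)

end Datum

end SWB

/-! ### The complement of a curve: separation as a parity condition -/

namespace SWB

theorem eq_of_reachable {V B : Type*} {G : SimpleGraph V} {g : V → B}
    (hg : ∀ x y, G.Adj x y → g x = g y) {x y : V} (h : G.Reachable x y) : g x = g y := by
  obtain ⟨p⟩ := h
  induction p with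
  | nil => rfl
  | cons h _ ih => exact (hg _ _ h).trans ih

namespace Frame

variable {N n m : ℕ} {F : Frame N n m}

/-- The gap `(j, a + 1/2)`. -/
def gapAt (F : Frame N n m) (j : Fin (2 * N + 2)) (a : ℕ) (h : a ≤ F.f j) : F.Gap :=
  ⟨(j, a + 1 / 2), a, h, rfl⟩

theorem exists_gapAt (g : F.Gap) : ∃ j a h, g = F.gapAt j a h := by
  obtain ⟨⟨j, x⟩, a, h1, h2⟩ := g
  simp only at h1 h2
  subst h2
  exact ⟨j, a, h1, rfl⟩

theorem bandGap_gapAt (j : Fin (2 * N + 2)) (a : ℕ) (h : a ≤ F.f j) :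
    F.bandGap (F.gapAt j a h) = F.gapAt (F.mate j) (if F.twist j = 0 then F.f j - a else a)
      (by rw [F.f_mate]; split_ifs <;> omega) := by
  refine Subtype.ext (Prod.ext rfl ?_)
  change (if F.twist j = 0 then (F.f j : ℚ) + 1 - (a + 1 / 2) else (a + 1 / 2 : ℚ)) =
    ((if F.twist j = 0 then F.f j - a else a : ℕ) : ℚ) + 1 / 2
  split_ifs
  · rw [Nat.cast_sub h]
    ring
  · rfl

theorem ofIndex_sigma_surjective (v : F.Vertex) : ∃ j a, v = F.ofIndex ⟨j, a⟩ := by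
  obtain ⟨⟨j, a⟩, rfl⟩ := F.ofIndex_bijective.2 v
  exact ⟨j, a, rfl⟩

/-- The gap next to a vertex `(j, a)` on the side of smaller `a`. -/
def lowerGap (v : F.Vertex) : F.Gap :=
  ⟨(v.1.1, v.1.2 - 1 / 2), by
    obtain ⟨j, a, rfl⟩ := ofIndex_sigma_surjective v
    refine ⟨a, a.2.le, ?_⟩
    simp only [ofIndex]
    push_cast
    ring⟩

/-- The gap next to a vertex `(j, a)` on the side of larger `a`. -/
def upperGap (v : F.Vertex) : F.Gap :=
  ⟨(v.1.1, v.1.2 + 1 / 2), by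
    obtain ⟨j, a, rfl⟩ := ofIndex_sigma_surjective v
    exact ⟨a + 1, a.2, rfl⟩⟩

theorem lowerGap_ofIndex (j : Fin (2 * N + 2)) (a : Fin (F.f j)) :
    lowerGap (F.ofIndex ⟨j, a⟩) = F.gapAt j a a.2.le := by
  refine Subtype.ext ?_
  simp only [lowerGap, ofIndex, gapAt, Prod.mk.injEq, true_and]
  push_cast
  ring

theorem upperGap_ofIndex (j : Fin (2 * N + 2)) (a : Fin (F.f j)) :
    upperGap (F.ofIndex ⟨j, a⟩) = F.gapAt j (a + 1) a.2 := rfl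

/-- An untwisted band reverses the coordinate and therefore exchanges the two sides of a strand; a
twisted one keeps it. -/
theorem bandGap_lowerGap (v : F.Vertex) :
    F.bandGap (lowerGap v) = if F.twist v.site = 0 then upperGap (F.bandVertex v)
      else lowerGap (F.bandVertex v) := by
  have : v.1.1 = v.site := rfl
  split_ifs with h <;> refine Subtype.ext ?_ <;>
    simp only [bandGap, bandVertex, lowerGap, upperGap, bandPoint, this, h, if_true, if_false,
      Prod.mk.injEq, true_and]
  ring

theorem bandGap_upperGap (v : F.Vertex) :
    F.bandGap (upperGap v) = if F.twist v.site = 0 then lowerGap (F.bandVertex v)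
      else upperGap (F.bandVertex v) := by
  have : v.1.1 = v.site := rfl
  split_ifs with h <;> refine Subtype.ext ?_ <;>
    simp only [bandGap, bandVertex, lowerGap, upperGap, bandPoint, this, h, if_true, if_false,
      Prod.mk.injEq, true_and]
  ring

theorem key_vertex_lt_key_gapAt {j k : Fin (2 * N + 2)} (hj : IsInner j) (a : Fin (F.f j)) {b : ℕ}
    (h : b ≤ F.f k) :
    key (F.ofIndex ⟨j, a⟩).1 < key (F.gapAt k b h).1 ↔ j < k ∨ j = k ∧ (a : ℕ) < b := by
  rw [key_lt_key_iff (x := (F.ofIndex ⟨j, a⟩).1) hj.2]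
  refine or_congr_right (and_congr_right fun _ => ?_)
  simp only [ofIndex, gapAt]
  constructor
  · intro h
    have : ((a : ℕ) : ℚ) < b := by push_cast at h; linarith
    exact_mod_cast this
  · intro h
    have : ((a + 1 : ℕ) : ℚ) ≤ b := by exact_mod_cast h
    linarith

theorem key_gap_ne_key_vertex (g : F.Gap) (v : F.Vertex) : key v.1 ≠ key g.1 := by
  intro h
  have h := congrArg Prod.snd (key_injective h)
  obtain ⟨k, a, _, hg⟩ := exists_gapAt g
  obtain ⟨j, b, rfl⟩ := ofIndex_sigma_surjective v
  rw [hg] at h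
  simp only [ofIndex, gapAt] at h
  -- Doubling turns the equality of an integer and a half-integer into one of an even and an odd
  -- number.
  have h2 : ((2 * (b + 1) : ℕ) : ℚ) = (2 * a + 1 : ℕ) := by
    push_cast at h ⊢
    linarith
  have h3 : 2 * ((b : ℕ) + 1) = 2 * a + 1 := by exact_mod_cast h2
  omega

theorem key_gap_lt_iff (g : F.Gap) (v : F.Vertex) : key g.1 < key v.1 ↔ ¬ key v.1 < key g.1 :=
  ⟨fun h => h.not_gt, fun h => lt_of_le_of_ne (not_lt.1 h) (key_gap_ne_key_vertex g v).symm⟩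

theorem key_lt_lowerGap_iff {v x : F.Vertex} (hx : IsInner x.site) :
    key x.1 < key (lowerGap v).1 ↔ x < v := by
  obtain ⟨j, a, rfl⟩ := ofIndex_sigma_surjective v
  obtain ⟨k, b, rfl⟩ := ofIndex_sigma_surjective x
  rw [lowerGap_ofIndex, key_vertex_lt_key_gapAt (j := k) hx, Vertex.lt_iff,
    key_lt_key_iff (x := (F.ofIndex ⟨k, b⟩).1) hx.2]
  simp [ofIndex]

theorem key_lt_upperGap_iff {v x : F.Vertex} (hx : IsInner x.site) (hv : IsInner v.site) :
    key x.1 < key (upperGap v).1 ↔ x ≤ v := by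
  obtain ⟨j, a, rfl⟩ := ofIndex_sigma_surjective v
  obtain ⟨k, b, rfl⟩ := ofIndex_sigma_surjective x
  rw [upperGap_ofIndex, key_vertex_lt_key_gapAt (j := k) hx, ← not_lt, Vertex.lt_iff,
    key_lt_key_iff (x := (F.ofIndex ⟨j, a⟩).1) hv.2]
  simp only [ofIndex, Nat.cast_lt]
  grind

/-- The vertices between two gaps. -/
def between (g h : F.Gap) : Set F.Vertex :=
  {x | key g.1 < key x.1 ∧ key x.1 < key h.1 ∨ key h.1 < key x.1 ∧ key x.1 < key g.1}

end Frame

namespace Datum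

open SWB.Frame

variable {N n m : ℕ} {Θ : Datum N n m}

/-- Gaps never coincide with vertices, so the edge condition of the complement graph says that the
set between the two gaps is closed under pairing. -/
theorem not_crosses_iff_between (g h : Θ.frame.Gap) (w : Θ.frame.Vertex) :
    ¬ Crosses (key g.1) (key h.1) (key w.1) (key (Θ.pair w).1) ↔
      (w ∈ between g h ↔ Θ.pair w ∈ between g h) := by
  rw [crosses_iff (key_gap_ne_key_vertex _ _) (key_gap_ne_key_vertex _ _)
    (key_gap_ne_key_vertex _ _) (key_gap_ne_key_vertex _ _), not_not]
  have : ∀ x : Θ.frame.Vertex, x ∈ between g h ↔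
      min (key g.1) (key h.1) < key x.1 ∧ key x.1 < max (key g.1) (key h.1) := by
    intro x
    simp only [between, Set.mem_ofPred_eq]
    rcases le_total (key g.1) (key h.1) with h1 | h1 <;>
      simp only [min_eq_left, min_eq_right, max_eq_left, max_eq_right, h1] <;> grind
  rw [this, this]

theorem complement_reachable {g h : Θ.frame.Gap}
    (hgh : ∀ w ∈ between g h, Θ.pair w ∈ between g h) : Θ.complementGraph.Reachable g h := by
  by_cases he : g = h
  · rw [he]
  · refine SimpleGraph.Adj.reachable ((SimpleGraph.fromRel_adj _ _ _).2
      ⟨he, Or.inl (Or.inr fun w => ?_)⟩)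
    rw [not_crosses_iff_between]
    exact ⟨hgh w, fun h => Θ.pair_pair w ▸ hgh _ h⟩

theorem complement_reachable_bandGap {g : Θ.frame.Gap} (hg : IsInner g.1.1) :
    Θ.complementGraph.Reachable g (Θ.frame.bandGap g) := by
  by_cases h : g = Θ.frame.bandGap g
  · rw [← h]
  · exact SimpleGraph.Adj.reachable ((SimpleGraph.fromRel_adj _ _ _).2
      ⟨h, Or.inl (Or.inl ⟨hg, rfl⟩)⟩)

/-- The tool for colourings: it suffices to check a colour along bands and across intervals closed
under pairing. -/
theorem eq_of_complement_reachable {B : Type*} {χ : Θ.frame.Gap → B}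
    (h1 : ∀ g, IsInner g.1.1 → χ g = χ (Θ.frame.bandGap g))
    (h2 : ∀ g h, (∀ w ∈ between g h, Θ.pair w ∈ between g h) → χ g = χ h) {g h : Θ.frame.Gap}
    (hgh : Θ.complementGraph.Reachable g h) : χ g = χ h := by
  have key : ∀ g h : Θ.frame.Gap, ((IsInner g.1.1 ∧ h = Θ.frame.bandGap g) ∨
      ∀ w : Θ.frame.Vertex, ¬ Crosses (key g.1) (key h.1) (key w.1) (key (Θ.pair w).1)) →
      χ g = χ h := by
    rintro g h (⟨hi, rfl⟩ | h)
    · exact h1 g hi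
    · exact h2 g _ fun w => ((not_crosses_iff_between _ _ w).1 (h w)).1
  refine eq_of_reachable (fun x y hxy => ?_) hgh
  rcases ((SimpleGraph.fromRel_adj _ _ _).1 hxy).2 with h | h
  · exact key _ _ h
  · exact (key _ _ h).symm

theorem pair_mem_Ioo {v x : Θ.frame.Vertex} (hx : x ∈ Set.Ioo v (Θ.pair v)) :
    Θ.pair x ∈ Set.Ioo v (Θ.pair v) := by
  have h := Θ.crossingless v x
  rw [crosses_iff hx.1.ne' hx.2.ne (fun h => hx.2.ne (by rw [← h, Θ.pair_pair]))
    (fun h => hx.1.ne' (by rw [← Θ.pair_pair x, h, Θ.pair_pair])), not_not,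
    min_eq_left (hx.1.trans hx.2).le, max_eq_right (hx.1.trans hx.2).le] at h
  exact h.1 hx

theorem pair_mem_Icc {v x : Θ.frame.Vertex} (hx : x ∈ Set.Icc v (Θ.pair v)) :
    Θ.pair x ∈ Set.Icc v (Θ.pair v) := by
  have hv := hx.1.trans hx.2
  rcases hx.1.eq_or_lt with rfl | h1
  · exact ⟨hv, le_rfl⟩
  rcases hx.2.eq_or_lt with rfl | h2
  · rw [Θ.pair_pair]
    exact ⟨le_rfl, hv⟩
  exact Set.Ioo_subset_Icc_self (pair_mem_Ioo ⟨h1, h2⟩)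

/-- The components of the complement on the two sides of a vertex. -/
def sides (Θ : Datum N n m) (v : Θ.frame.Vertex) :
    Set Θ.complementGraph.ConnectedComponent :=
  {Θ.complementGraph.connectedComponentMk (lowerGap v),
    Θ.complementGraph.connectedComponentMk (upperGap v)}

/-- One can walk along an arc of the square on either side. The gaps just outside its ends enclose a
closed interval and those just inside an open one, and neither interval is left by a pair, as pairs
do not cross. -/
theorem complement_reachable_pair (hin : ∀ v : Θ.frame.Vertex, IsInner v.site)
    {v : Θ.frame.Vertex} (hv : v < Θ.pair v) :
    Θ.complementGraph.Reachable (lowerGap v) (upperGap (Θ.pair v)) ∧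
      Θ.complementGraph.Reachable (upperGap v) (lowerGap (Θ.pair v)) := by
  have h1 : between (lowerGap v) (upperGap (Θ.pair v)) = Set.Icc v (Θ.pair v) := by
    ext x
    simp only [between, Set.mem_ofPred_eq, key_gap_lt_iff, key_lt_lowerGap_iff (hin _),
      key_lt_upperGap_iff (hin _) (hin _), Set.mem_Icc, not_lt, not_le]
    exact or_iff_left fun h => absurd (hv.trans h.1) h.2.not_gt
  have h2 : between (upperGap v) (lowerGap (Θ.pair v)) = Set.Ioo v (Θ.pair v) := by
    ext x
    simp only [between, Set.mem_ofPred_eq, key_gap_lt_iff, key_lt_lowerGap_iff (hin _),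
      key_lt_upperGap_iff (hin _) (hin _), Set.mem_Ioo, not_lt, not_le]
    exact or_iff_left fun h => absurd (hv.trans_le h.1) h.2.not_gt
  exact ⟨complement_reachable fun w hw => by rw [h1] at hw ⊢; exact pair_mem_Icc hw,
    complement_reachable fun w hw => by rw [h2] at hw ⊢; exact pair_mem_Ioo hw⟩

theorem sides_pair (hin : ∀ v : Θ.frame.Vertex, IsInner v.site) (v : Θ.frame.Vertex) :
    Θ.sides (Θ.pair v) = Θ.sides v := by
  have h : ∀ {v}, v < Θ.pair v → Θ.sides (Θ.pair v) = Θ.sides v := fun {v} hv => by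
    obtain ⟨h1, h2⟩ := complement_reachable_pair hin hv
    rw [sides, sides, SimpleGraph.ConnectedComponent.eq.2 h1,
      SimpleGraph.ConnectedComponent.eq.2 h2, Set.pair_comm]
  rcases (Θ.pair_ne v).lt_or_gt with hv | hv
  · have := h (v := Θ.pair v) (by rwa [Θ.pair_pair])
    rw [Θ.pair_pair] at this
    exact this.symm
  · exact h hv

theorem sides_bandVertex {v : Θ.frame.Vertex} (hv : IsInner v.site) :
    Θ.sides (Θ.frame.bandVertex v) = Θ.sides v := by
  have h1 : Θ.complementGraph.connectedComponentMk (lowerGap v) = _ :=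
    SimpleGraph.ConnectedComponent.eq.2 (complement_reachable_bandGap hv)
  have h2 : Θ.complementGraph.connectedComponentMk (upperGap v) = _ :=
    SimpleGraph.ConnectedComponent.eq.2 (complement_reachable_bandGap hv)
  rw [bandGap_lowerGap] at h1
  rw [bandGap_upperGap] at h2
  rw [sides, sides, h1, h2]
  split_ifs
  · exact Set.pair_comm _ _
  · rfl

/-- A gap is joined to the nearest vertex before it, or to the first vertex if there is none, since
no vertex lies in between. So every region touches the curve. -/
theorem exists_mem_sides (hin : ∀ v : Θ.frame.Vertex, IsInner v.site) [Nonempty Θ.frame.Vertex]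
    (Δ : Θ.complementGraph.ConnectedComponent) : ∃ v, Δ ∈ Θ.sides v := by
  induction Δ using SimpleGraph.ConnectedComponent.ind with | _ g
  rcases Set.eq_empty_or_nonempty {v : Θ.frame.Vertex | key v.1 < key g.1} with hA | hA
  · obtain ⟨v, hv⟩ := Finite.exists_min (id : Θ.frame.Vertex → _)
    refine ⟨v, Or.inl (SimpleGraph.ConnectedComponent.eq.2 (complement_reachable fun x hx => ?_))⟩
    simp only [between, Set.mem_ofPred_eq, key_gap_lt_iff, key_lt_lowerGap_iff (hin _)] at hx
    rcases hx with hx | hx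
    · exact absurd (hv x) (not_le.2 hx.2)
    · exact absurd hx.2 (Set.eq_empty_iff_forall_notMem.1 hA x)
  · obtain ⟨v, hvA, hv⟩ := Set.exists_max_image _ id (Set.toFinite _) hA
    refine ⟨v, Or.inr (SimpleGraph.ConnectedComponent.eq.2 (complement_reachable fun x hx => ?_))⟩
    simp only [between, Set.mem_ofPred_eq, key_gap_lt_iff,
      key_lt_upperGap_iff (hin _) (hin _)] at hx
    rcases hx with hx | hx
    · exact absurd (lt_of_le_of_lt (show key x.1 ≤ key v.1 from hx.2) hvA) hx.1
    · exact absurd (hv x hx.2) hx.1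

/-- The pair of adjacent regions does not change along the curve, so a connected curve has at most
two regions around it, and these are all. -/
theorem sides_eq_univ (hin : ∀ v : Θ.frame.Vertex, IsInner v.site)
    (hconn : ∀ v w, Θ.curveGraph.Reachable v w) (v : Θ.frame.Vertex) :
    Θ.sides v = Set.univ := by
  have : Nonempty Θ.frame.Vertex := ⟨v⟩
  refine Set.eq_univ_of_forall fun Δ => ?_
  obtain ⟨w, hw⟩ := exists_mem_sides hin Δ
  have h : Θ.sides w = Θ.sides v := reachable_iff.1 (hconn v w) (fun u => Θ.sides u = Θ.sides v)
    ⟨fun u hu => (sides_pair hin u).trans hu, fun _ hi hu => (sides_bandVertex hi).trans hu⟩ rfl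
  rwa [← h]

theorem card_complement_eq_two_iff_not_reachable (hin : ∀ v : Θ.frame.Vertex, IsInner v.site)
    (hconn : ∀ v w, Θ.curveGraph.Reachable v w) (v : Θ.frame.Vertex) :
    Nat.card Θ.complementGraph.ConnectedComponent = 2 ↔
      ¬ Θ.complementGraph.Reachable (lowerGap v) (upperGap v) := by
  rw [← Set.ncard_univ, ← sides_eq_univ hin hconn v, sides, ← SimpleGraph.ConnectedComponent.eq]
  constructor
  · intro h he
    rw [he, Set.pair_eq_singleton, Set.ncard_singleton] at h
    omega
  · exact fun h => Set.ncard_pair h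

theorem even_ncard_between {g h : Θ.frame.Gap}
    (hgh : ∀ w ∈ between g h, Θ.pair w ∈ between g h) : Even (between g h).ncard :=
  even_ncard_of_involution Θ.pair_pair Θ.pair_ne hgh

theorem ncard_lt_key_add {g h : Θ.frame.Gap} (hgh : key g.1 ≤ key h.1) :
    {w : Θ.frame.Vertex | key w.1 < key g.1}.ncard + (between g h).ncard =
      {w : Θ.frame.Vertex | key w.1 < key h.1}.ncard := by
  rw [← Set.ncard_union_eq]
  · refine congrArg Set.ncard (Set.ext fun x => ?_)
    have := key_gap_ne_key_vertex g x
    simp only [between, Set.mem_union, Set.mem_ofPred_eq]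
    grind
  · rw [Set.disjoint_left]
    intro x hx
    simp only [between, Set.mem_ofPred_eq] at hx ⊢
    grind

/-- The number of preceding vertices changes by an even number along an edge inside the square,
because the vertices between the gaps are paired among themselves. -/
theorem ncard_lt_key_mod_two {g h : Θ.frame.Gap}
    (hgh : ∀ w ∈ between g h, Θ.pair w ∈ between g h) :
    ({w : Θ.frame.Vertex | key w.1 < key g.1}.ncard : ZMod 2) =
      {w : Θ.frame.Vertex | key w.1 < key h.1}.ncard := by
  have he := (ZMod.natCast_eq_zero_iff_even).2 (even_ncard_between hgh)
  rcases le_total (key g.1) (key h.1) with h1 | h1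
  · rw [← ncard_lt_key_add h1, Nat.cast_add, he, add_zero]
  · rw [← ncard_lt_key_add h1, Nat.cast_add, show between h g = between g h from
      Set.ext fun x => or_comm, he, add_zero]

theorem even_ncard_site_lt (hf : ∀ j, Even (Θ.frame.f j)) (j : Fin (2 * N + 2)) :
    Even {w : Θ.frame.Vertex | w.site < j}.ncard := by
  classical
  have := Fintype.ofFinite Θ.frame.Vertex
  rw [Set.ncard_eq_toFinset_card', Finset.card_eq_sum_card_fiberwise (f := Vertex.site)
    (t := Finset.Iio j) (fun w hw => by simpa using hw)]
  refine Finset.even_sum _ fun k hk => ?_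
  have h : Even {w : Θ.frame.Vertex | w.site = k}.ncard := Θ.frame.ncard_site k ▸ hf k
  rw [Set.ncard_eq_toFinset_card'] at h
  refine (congrArg Even (congrArg Finset.card (Finset.ext fun w => ?_))).mpr h
  simp only [Finset.mem_Iio] at hk
  simp only [Finset.mem_filter, Set.mem_toFinset, Set.mem_ofPred_eq, and_iff_right_iff_imp]
  exact fun h => h ▸ hk

theorem ncard_lt_key_gapAt (hin : ∀ v : Θ.frame.Vertex, IsInner v.site)
    (hf : ∀ j, Even (Θ.frame.f j)) (j : Fin (2 * N + 2)) (a : ℕ) (h : a ≤ Θ.frame.f j) :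
    ({w : Θ.frame.Vertex | key w.1 < key (Θ.frame.gapAt j a h).1}.ncard : ZMod 2) = a := by
  let r : Fin a → Θ.frame.Vertex := fun b => Θ.frame.ofIndex ⟨j, Fin.castLE h b⟩
  have hr : Function.Injective r := fun b c hbc => by
    simpa using Θ.frame.ofIndex_bijective.1 hbc
  have hset : {w : Θ.frame.Vertex | key w.1 < key (Θ.frame.gapAt j a h).1} =
      {w : Θ.frame.Vertex | w.site < j} ∪ Set.range r := by
    ext w
    obtain ⟨k, b, rfl⟩ := ofIndex_sigma_surjective w
    have hk : (Θ.frame.ofIndex ⟨k, b⟩).site = k := rfl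
    have hki : IsInner k := hin (Θ.frame.ofIndex ⟨k, b⟩)
    simp only [Set.mem_ofPred_eq, Set.mem_union, Set.mem_range,
      key_vertex_lt_key_gapAt hki, hk]
    refine or_congr_right ⟨?_, ?_⟩
    · rintro ⟨rfl, hb⟩
      exact ⟨⟨b, hb⟩, rfl⟩
    · rintro ⟨c, hc⟩
      have := Θ.frame.ofIndex_bijective.1 hc
      simp only [Sigma.mk.injEq] at this
      obtain ⟨rfl, h2⟩ := this
      exact ⟨rfl, eq_of_heq h2 ▸ c.2⟩
  rw [hset, Set.ncard_union_eq, Nat.cast_add,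
    (ZMod.natCast_eq_zero_iff_even).2 (even_ncard_site_lt hf j), zero_add,
    ← Nat.card_coe_set_eq, Nat.card_range_of_injective hr, Nat.card_fin]
  rw [Set.disjoint_left]
  rintro _ hx ⟨b, rfl⟩
  exact lt_irrefl j hx

/-- The chessboard colouring has value `a` at the gap `(j, a + 1/2)`. A band sends `a` to `a` or to
`f j - a`, which is the same modulo 2, while the gaps next to a vertex have different colours. -/
theorem not_reachable_of_even (hin : ∀ v : Θ.frame.Vertex, IsInner v.site)
    (hf : ∀ j, Even (Θ.frame.f j)) (v : Θ.frame.Vertex) :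
    ¬ Θ.complementGraph.Reachable (lowerGap v) (upperGap v) := by
  intro h
  have h := eq_of_complement_reachable (χ := fun g =>
    ({w : Θ.frame.Vertex | key w.1 < key g.1}.ncard : ZMod 2)) (fun g _ => ?_)
    (fun g h hgh => ncard_lt_key_mod_two hgh) h
  · obtain ⟨j, a, rfl⟩ := ofIndex_sigma_surjective v
    simp only [lowerGap_ofIndex, upperGap_ofIndex, ncard_lt_key_gapAt hin hf] at h
    rw [Nat.cast_succ, left_eq_add] at h
    exact one_ne_zero h
  · obtain ⟨j, a, ha, rfl⟩ := exists_gapAt g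
    simp only [bandGap_gapAt, ncard_lt_key_gapAt hin hf]
    split_ifs
    · have h2 := (ZMod.natCast_eq_zero_iff_even).2 (hf j)
      rw [Nat.cast_sub ha, h2, zero_sub, ZMod.neg_eq_self_mod_two]
    · rfl

theorem even_of_not_reachable (hin : ∀ v : Θ.frame.Vertex, IsInner v.site)
    (hconn : ∀ v w, Θ.curveGraph.Reachable v w) (v : Θ.frame.Vertex)
    (hv : ¬ Θ.complementGraph.Reachable (lowerGap v) (upperGap v)) (j : Fin (2 * N + 2)) :
    Even (Θ.frame.f j) := by
  classical
  by_cases hj : IsInner j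
  swap
  · rw [← ncard_site, show {v : Θ.frame.Vertex | v.site = j} = ∅ from
      Set.eq_empty_iff_forall_notMem.2 fun v hv => hj (hv ▸ hin v), Set.ncard_empty]
    exact Even.zero
  -- The two regions are coloured `0` and `1`; the colour changes at every vertex, hence `a` times
  -- between the gaps `0` and `a` of a site.
  let χ : Θ.frame.Gap → ZMod 2 := fun g =>
    if Θ.complementGraph.Reachable (lowerGap v) g then 0 else 1
  have hχ : ∀ {g h}, Θ.complementGraph.Reachable g h → χ g = χ h := fun {g h} hgh => by
    have : Θ.complementGraph.Reachable (lowerGap v) g ↔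
      Θ.complementGraph.Reachable (lowerGap v) h := ⟨fun h => h.trans hgh, fun h => h.trans hgh.symm⟩
    simp only [χ, this]
  have hside : ∀ w, χ (upperGap w) = χ (lowerGap w) + 1 := by
    intro w
    have hw : ¬ Θ.complementGraph.Reachable (lowerGap w) (upperGap w) :=
      (card_complement_eq_two_iff_not_reachable hin hconn w).1
        ((card_complement_eq_two_iff_not_reachable hin hconn v).2 hv)
    have hmem : Θ.complementGraph.connectedComponentMk (lowerGap v) ∈ Θ.sides w := by
      rw [sides_eq_univ hin hconn w]
      trivial
    rcases hmem with h | h <;> replace h := SimpleGraph.ConnectedComponent.eq.1 h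
    · have h' : ¬ Θ.complementGraph.Reachable (lowerGap v) (upperGap w) :=
        fun h' => hw (h.symm.trans h')
      simp only [χ, if_pos h, if_neg h', zero_add]
    · have h' : ¬ Θ.complementGraph.Reachable (lowerGap v) (lowerGap w) :=
        fun h' => hw (h'.symm.trans h)
      simp only [χ, if_pos h, if_neg h']
      decide
  have hstep : ∀ (j) (a : ℕ) (ha : a ≤ Θ.frame.f j),
      χ (Θ.frame.gapAt j a ha) = χ (Θ.frame.gapAt j 0 (Nat.zero_le _)) + a := by
    intro j a
    induction a with
    | zero => simp
    | succ a ih =>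
      intro ha
      have := hside (Θ.frame.ofIndex ⟨j, ⟨a, ha⟩⟩)
      rw [upperGap_ofIndex, lowerGap_ofIndex] at this
      rw [this, ih]
      push_cast
      ring
  -- The vertices `(i, -1)` and `(i, 1)` of the boundary graph are the first and the last gap at the
  -- site `i`.
  let ψ : {i : Fin (2 * N + 2) // IsInner i} × ℤˣ → ZMod 2 := fun x =>
    χ (Θ.frame.gapAt x.1 (if x.2 = 1 then Θ.frame.f x.1 else 0) (by split_ifs <;> omega))
  have hψ : ∀ x y : {i : Fin (2 * N + 2) // IsInner i} × ℤˣ,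
      ((x.2 = 1 ∧ y.2 = -1 ∧ (y.1.1 : ℕ) = (x.1.1 : ℕ) + 1) ∨
        (y.1.1 = Θ.frame.mate x.1.1 ∧ y.2 = if Θ.frame.twist x.1.1 = 0 then -x.2 else x.2)) →
      ψ x = ψ y := by
    rintro ⟨⟨i, hi⟩, δ⟩ ⟨⟨k, hk⟩, η⟩ (⟨h1, h2, h3⟩ | ⟨h1, h2⟩)
    · simp only at h1 h2 h3
      subst h1 h2
      refine hχ (complement_reachable fun w hw => ?_)
      -- There is no vertex between the last gap of a site and the first gap of the next one.
      exfalso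
      obtain ⟨l, b, rfl⟩ := ofIndex_sigma_surjective w
      have := b.2
      have hl : IsInner l := hin (Θ.frame.ofIndex ⟨l, b⟩)
      simp only [between, Set.mem_ofPred_eq, key_gap_lt_iff,
        key_vertex_lt_key_gapAt hl] at hw
      simp only [Fin.lt_def, Fin.ext_iff] at hw
      rcases hw with hw | hw
      · have h4 : (l : ℕ) ≠ i := fun h => by
          have := Fin.ext h
          subst this
          simp at hw
        have : ¬ (-1 : ℤˣ) = 1 := by decide
        simp only [this, if_false] at hw
        omega
      · omega
    · simp only at h1 h2
      subst h1 h2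
      refine (hχ (complement_reachable_bandGap hi)).trans ?_
      rw [bandGap_gapAt]
      refine congrArg χ ?_
      refine Subtype.ext ?_
      rcases Int.units_eq_one_or δ with rfl | rfl <;> by_cases ht : Θ.frame.twist i = 0 <;>
        simp [gapAt, ht, Θ.frame.f_mate]
  -- The single boundary component enters here: it joins the two edges of the band at `j`, so the
  -- colour changes an even number of times between them.
  have hconst := eq_of_reachable (g := ψ) (fun x y hxy => by
    rcases ((SimpleGraph.fromRel_adj _ _ _).1 hxy).2 with h | h
    · exact hψ x y h
    · exact (hψ y x h).symm) (Θ.frame.one_boundary (⟨j, hj⟩, 1) (⟨j, hj⟩, -1))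
  have h1 : ψ (⟨j, hj⟩, 1) = χ (Θ.frame.gapAt j 0 (Nat.zero_le _)) + Θ.frame.f j :=
    hstep j (Θ.frame.f j) le_rfl
  have h2 : ψ (⟨j, hj⟩, -1) = χ (Θ.frame.gapAt j 0 (Nat.zero_le _)) := rfl
  rw [h1, h2] at hconst
  exact (ZMod.natCast_eq_zero_iff_even).1 (by simpa using hconst)

/-- A connected curve which misses the sites `0` and `2N + 1` disconnects the surface if and only
if it runs an even number of times through every band. -/
theorem card_complement_eq_two_iff (hin : ∀ v : Θ.frame.Vertex, IsInner v.site)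
    (hconn : ∀ v w, Θ.curveGraph.Reachable v w) [h : Nonempty Θ.frame.Vertex] :
    Nat.card Θ.complementGraph.ConnectedComponent = 2 ↔ ∀ j, Even (Θ.frame.f j) := by
  obtain ⟨v⟩ := h
  rw [card_complement_eq_two_iff_not_reachable hin hconn v]
  exact ⟨even_of_not_reachable hin hconn v, fun hf => not_reachable_of_even hin hf v⟩

end Datum

end SWB

/-! ### The weight, deletions and pull-throughs -/

namespace SWB

namespace Datum

open SWB.Frame

variable {N n m n' m' : ℕ} {Θ : Datum N n m} {Θ' : Datum N n' m'}

/-- Invariance of `W` is not needed, so this also covers pull-throughs, where `W` cuts through a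
component. -/
theorem siteCount_componentOf_orderIso {W : Set Θ.frame.Vertex} (o : W ≃o Θ'.frame.Vertex)
    (hs : ∀ x, (o x).site = x.1.site)
    (hr : ∀ x y, Θ'.curveGraph.Reachable (o x) (o y) ↔ Θ.curveGraph.Reachable x.1 y.1)
    (x : W) (j : Fin (2 * N + 2)) :
    (Θ'.componentOf (o x)).siteCount j =
      {v | v ∈ W ∧ v ∈ (Θ.componentOf x).supp ∧ v.site = j}.ncard := by
  have h1 : {v | v ∈ (Θ'.componentOf (o x)).supp ∧ v.site = j} =
      o '' {y | y.1 ∈ (Θ.componentOf x).supp ∧ y.1.site = j} := by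
    ext v
    obtain ⟨y, rfl⟩ := o.surjective v
    simp only [Set.mem_ofPred_eq, o.injective.mem_set_image, mem_supp_iff, hs, componentOf_eq_iff,
      hr]
  have h2 : {v | v ∈ W ∧ v ∈ (Θ.componentOf x).supp ∧ v.site = j} =
      Subtype.val '' {y : W | y.1 ∈ (Θ.componentOf x).supp ∧ y.1.site = j} := by
    ext v
    exact ⟨fun h => ⟨⟨v, h.1⟩, h.2, rfl⟩, by rintro ⟨y, hy, rfl⟩; exact ⟨y.2, hy⟩⟩
  rw [Component.siteCount, h1, h2, Set.ncard_image_of_injective _ o.injective,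
    Set.ncard_image_of_injective _ Subtype.val_injective]

theorem IsRestriction.exists_orderIso {S : Set Θ.frame.Vertex} (hS : Θ.IsInvariant (· ∈ S))
    (h : Θ.IsRestriction S Θ') :
    ∃ o : S ≃o Θ'.frame.Vertex, (∀ x, (o x).site = x.1.site) ∧
      ∀ x y, Θ'.curveGraph.Reachable (o x) (o y) ↔ Θ.curveGraph.Reachable x.1 y.1 := by
  obtain ⟨hT, hf, o, ho⟩ := h
  have hs := site_orderIso o hf
  have hb := bandVertex_orderIso o hT hf fun v hv hi => hS.2 v hi hv
  refine ⟨o, hs, fun x y => ⟨fun h => ?_, fun h => ?_⟩⟩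
  · refine reachable_iff.2 fun c hc hx => ?_
    have := reachable_iff.1 h (fun v => c (o.symm v).1) ⟨fun v hv => ?_, fun v hi hv => ?_⟩
      (by simpa using hx)
    · simpa using this
    · obtain ⟨z, rfl⟩ := o.surjective v
      rw [ho z ⟨Θ.pair z, hS.1 z z.2⟩ rfl]
      simp only [OrderIso.symm_apply_apply] at hv ⊢
      exact hc.1 _ hv
    · obtain ⟨z, rfl⟩ := o.surjective v
      rw [hs] at hi
      rw [hb z hi]
      simp only [OrderIso.symm_apply_apply] at hv ⊢
      exact hc.2 _ hi hv
  · refine reachable_iff.2 fun c hc hx => ?_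
    suffices hinv : Θ.IsInvariant fun v => ∃ hv : v ∈ S, c (o ⟨v, hv⟩) from
      (reachable_iff.1 h _ hinv ⟨x.2, hx⟩).2
    refine ⟨fun v hv => ?_, fun v hi hv => ?_⟩
    · obtain ⟨hvS, hv⟩ := hv
      refine ⟨hS.1 v hvS, ?_⟩
      rw [← ho ⟨v, hvS⟩ ⟨Θ.pair v, hS.1 v hvS⟩ rfl]
      exact hc.1 _ hv
    · obtain ⟨hvS, hv⟩ := hv
      refine ⟨hS.2 v hi hvS, ?_⟩
      rw [← hb ⟨v, hvS⟩ hi]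
      exact hc.2 _ (by rwa [hs]) hv

theorem IsRestriction.siteCount_eq {S : Set Θ.frame.Vertex} (hS : Θ.IsInvariant (· ∈ S))
    (o : S ≃o Θ'.frame.Vertex) (hs : ∀ x, (o x).site = x.1.site)
    (hr : ∀ x y, Θ'.curveGraph.Reachable (o x) (o y) ↔ Θ.curveGraph.Reachable x.1 y.1)
    (x : S) : (Θ'.componentOf (o x)).siteCount = (Θ.componentOf x).siteCount := by
  funext j
  rw [siteCount_componentOf_orderIso o hs hr x j]
  refine congrArg Set.ncard (Set.ext fun v => ⟨fun h => h.2, fun h => ⟨?_, h⟩⟩)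
  exact reachable_iff.1 (componentOf_eq_iff.1 (mem_supp_iff.1 h.1)).symm _ hS x.2

theorem card_complement_of_isRestriction {Γ : Θ.Component} (hΓ : Γ.IsInternal)
    (h : Θ.IsRestriction Γ.supp Θ') :
    Nat.card Θ'.complementGraph.ConnectedComponent = 2 ↔ ∀ j, Even (Γ.siteCount j) := by
  obtain ⟨o, hs, hr⟩ := h.exists_orderIso (isInvariant_supp Γ)
  have hf : ∀ j, Θ'.frame.f j = Γ.siteCount j := h.2.1
  obtain ⟨v, hv⟩ := exists_componentOf Γ
  have : Nonempty Θ'.frame.Vertex := ⟨o ⟨v, hv⟩⟩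
  simp only [← hf]
  refine card_complement_eq_two_iff (fun w => ?_) fun w z => ?_
  · obtain ⟨x, rfl⟩ := o.surjective w
    rw [hs]
    exact hΓ _ x.2
  · obtain ⟨x, rfl⟩ := o.surjective w
    obtain ⟨y, rfl⟩ := o.surjective z
    rw [hr, ← componentOf_eq_iff]
    exact (mem_supp_iff.1 x.2).trans (mem_supp_iff.1 y.2).symm

/-- An internal component is separating if and only if it runs an even number of times through
every band. -/
theorem Component.isSeparating_iff {Γ : Θ.Component} (hΓ : Γ.IsInternal) :
    Γ.IsSeparating ↔ ∀ j, Even (Γ.siteCount j) := by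
  constructor
  · rintro ⟨_, _, Θ', h, hc⟩
    exact (card_complement_of_isRestriction hΓ h).1 hc
  · intro h
    obtain ⟨Θ', hΘ'⟩ := exists_isRestriction (isInvariant_supp Γ) rfl rfl
    exact ⟨_, _, Θ', hΘ', (card_complement_of_isRestriction hΓ hΘ').2 h⟩

/-- Separating and twisted exclude each other, so the relations never demand both `α` and `β` for
one component. -/
theorem Component.twist_eq_zero_of_even {Γ : Θ.Component} (h : ∀ j, Even (Γ.siteCount j)) :
    Γ.twist = 0 := by
  classical
  refine Finset.sum_eq_zero fun j _ => ?_
  have := (ZMod.natCast_eq_zero_iff_even).2 (h j)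
  rw [siteCount] at this
  rw [this, zero_mul, ite_self]

open Classical in
/-- The factor contributed by a component. -/
noncomputable def Component.factor {K : Type*} [CommRing K] (α β γ : K) (Γ : Θ.Component) : K :=
  if Γ.IsInternal then
    if ∀ j, Even (Γ.siteCount j) then α else if Γ.twist = 1 then β else γ
  else 1

noncomputable instance : Fintype Θ.Component := Fintype.ofFinite _

/-- The product of the factors of all components. -/
noncomputable def weight {K : Type*} [CommRing K] (α β γ : K) (Θ : Datum N n m) : K :=
  ∏ Γ : Θ.Component, Γ.factor α β γ

section Weight

variable {K : Type*} [CommRing K] {α β γ : K}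

/-- The map `r` induces an injection of components, and those missed contribute `1`. The function
`g` is left free so that a deletion can overwrite one factor by `1`. -/
theorem weight_eq_prod {N₁ n₁ m₁ N₂ n₂ m₂ : ℕ} {Θ₁ : Datum N₁ n₁ m₁} {Θ₂ : Datum N₂ n₂ m₂}
    {r : Θ₁.frame.Vertex → Θ₂.frame.Vertex}
    (hr : ∀ x y, Θ₁.curveGraph.Reachable x y ↔ Θ₂.curveGraph.Reachable (r x) (r y))
    {g : Θ₂.Component → K} (hg : ∀ x, (Θ₁.componentOf x).factor α β γ = g (Θ₂.componentOf (r x)))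
    (h1 : ∀ Γ, (∀ x, Θ₂.componentOf (r x) ≠ Γ) → g Γ = 1) : Θ₁.weight α β γ = ∏ Γ, g Γ := by
  choose s hs using exists_componentOf (Θ := Θ₁)
  refine Fintype.prod_of_injective (fun Γ => Θ₂.componentOf (r (s Γ))) (fun Γ Δ h => ?_) _ _
    (fun Γ hΓ => h1 Γ fun x hx => hΓ ⟨Θ₁.componentOf x, ?_⟩) fun Γ => ?_
  · rw [← hs Γ, ← hs Δ, componentOf_eq_iff, hr]
    exact componentOf_eq_iff.1 h
  · refine Eq.trans ?_ hx
    simp only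
    rw [componentOf_eq_iff, ← hr, ← componentOf_eq_iff, hs]
  · rw [← hg, hs]

theorem factor_congr {Γ : Θ.Component} {Γ' : Θ'.Component}
    (hT : Θ'.frame.toTwistedChordDatum = Θ.frame.toTwistedChordDatum)
    (hin : Γ'.IsInternal ↔ Γ.IsInternal)
    (h : ∀ j, (Γ'.siteCount j : ZMod 2) = Γ.siteCount j) :
    Γ'.factor α β γ = Γ.factor α β γ := by
  have hm : Θ'.frame.mate = Θ.frame.mate := congrArg TwistedChordDatum.mate hT
  have ht : Θ'.frame.twist = Θ.frame.twist := congrArg TwistedChordDatum.twist hT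
  have h1 : (∀ j, Even (Γ'.siteCount j)) ↔ ∀ j, Even (Γ.siteCount j) := by
    simp only [← ZMod.natCast_eq_zero_iff_even, h]
  have h2 : Γ'.twist = Γ.twist := by
    unfold Component.twist
    rw [hm, ht]
    refine Finset.sum_congr rfl fun j _ => ?_
    have := h j
    unfold Component.siteCount at this
    rw [this]
  simp only [Component.factor, h1, h2]
  classical exact if_congr hin rfl rfl

theorem weight_of_isDeletion {Γ : Θ.Component} (h : Θ.IsDeletion Γ Θ') :
    Θ.weight α β γ = Γ.factor α β γ * Θ'.weight α β γ := by
  classical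
  obtain ⟨o, hs, hr⟩ := IsRestriction.exists_orderIso (isInvariant_compl_supp Γ) h
  have hc := IsRestriction.siteCount_eq (isInvariant_compl_supp Γ) o hs hr
  rw [weight_eq_prod (Θ₁ := Θ') (r := fun v => (o.symm v).1)
    (g := Function.update (fun Δ => Δ.factor α β γ) Γ 1) (fun x y => ?_) (fun x => ?_)
    fun Δ hΔ => ?_]
  · rw [weight, Finset.prod_update_of_mem (Finset.mem_univ _), one_mul, Finset.sdiff_singleton_eq_erase,
      Finset.mul_prod_erase _ _ (Finset.mem_univ _)]
  · rw [← hr, OrderIso.apply_symm_apply, OrderIso.apply_symm_apply]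
  · obtain ⟨y, rfl⟩ := o.surjective x
    rw [OrderIso.symm_apply_apply, Function.update_of_ne (a := Θ.componentOf y.1) fun h => y.2 h]
    exact factor_congr h.1 (by simp only [Component.isInternal_iff, hc]) fun j => by rw [hc]
  · by_cases hΔΓ : Δ = Γ
    · rw [hΔΓ, Function.update_self]
    · exfalso
      obtain ⟨v, rfl⟩ := exists_componentOf Δ
      exact hΔ (o ⟨v, hΔΓ⟩) (by rw [OrderIso.symm_apply_apply])

/-- The four removed vertices belong to one component, which loses two strands in a single band. It
does not vanish: as the other two ends are not paired with each other, their partners survive. -/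
theorem weight_of_isPullThrough {Θ' : Datum N n m} {Θ : Datum N n m} (h : Θ.IsPullThrough Θ') :
    Θ'.weight α β γ = Θ.weight α β γ := by
  classical
  obtain ⟨u, v, hi, hvs, hv2, huv, hne, hT, hf, hex⟩ := h
  set ι := Θ.frame.bandVertex with hι
  have hm := (Θ.frame.isInner_iff_mate_ne u.site).1 hi
  have hvu : Θ.pair v = u := by rw [← huv, Θ.pair_pair]
  have huv' : u ≠ v := fun h => Θ.pair_ne u (huv.trans h.symm)
  have hsu : (ι u).site = Θ.frame.mate u.site := rfl
  have hsv : (ι v).site = Θ.frame.mate u.site := by rw [← hvs]; rfl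
  have hii : ∀ w, ι (ι w) = w := bandVertex_bandVertex
  set W : Set Θ.frame.Vertex := {u, v, ι u, ι v}ᶜ with hW
  obtain ⟨o, ho⟩ := hex
  have hWmem : ∀ w, w ∈ W ↔ ¬ (w = u ∨ w = v ∨ w = ι u ∨ w = ι v) := fun w => Iff.rfl
  have hcompl : ∀ j, {w | w ∉ W ∧ w.site = j}.ncard =
      if j = u.site ∨ j = Θ.frame.mate u.site then 2 else 0 := by
    intro j
    split_ifs with hj
    · rcases hj with rfl | rfl
      · refine (congrArg Set.ncard (Set.ext fun w => ?_)).trans (Set.ncard_pair huv')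
        simp only [Set.mem_ofPred_eq, hWmem, not_not, Set.mem_insert_iff, Set.mem_singleton_iff]
        constructor
        · rintro ⟨rfl | rfl | rfl | rfl, hs⟩
          · exact Or.inl rfl
          · exact Or.inr rfl
          · exact absurd hs hm
          · exact absurd (hsv.symm.trans hs) hm
        · rintro (rfl | rfl)
          · exact ⟨Or.inl rfl, rfl⟩
          · exact ⟨Or.inr (Or.inl rfl), hvs⟩
      · refine (congrArg Set.ncard (Set.ext fun w => ?_)).trans
          (Set.ncard_pair (bandVertex_injective.ne huv'))
        simp only [Set.mem_ofPred_eq, hWmem, not_not, Set.mem_insert_iff, Set.mem_singleton_iff]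
        constructor
        · rintro ⟨rfl | rfl | rfl | rfl, hs⟩
          · exact absurd hs.symm hm
          · exact absurd (hs.symm.trans hvs) hm
          · exact Or.inl rfl
          · exact Or.inr rfl
        · rintro (rfl | rfl)
          · exact ⟨Or.inr (Or.inr (Or.inl rfl)), rfl⟩
          · exact ⟨Or.inr (Or.inr (Or.inr rfl)), hsv⟩
    · rw [Set.ncard_eq_zero (Set.toFinite _), Set.eq_empty_iff_forall_notMem]
      rintro w ⟨hw, rfl⟩
      rw [hWmem, not_not] at hw
      rcases hw with rfl | rfl | rfl | rfl
      · exact hj (Or.inl rfl)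
      · exact hj (Or.inl hvs)
      · exact hj (Or.inr rfl)
      · exact hj (Or.inr hsv)
  have hfW : ∀ j, Θ'.frame.f j = {w | w ∈ W ∧ w.site = j}.ncard := by
    intro j
    have h1 : {w | w ∈ W ∧ w.site = j}.ncard + {w | w ∉ W ∧ w.site = j}.ncard = Θ.frame.f j := by
      rw [← ncard_site, ← Set.ncard_union_eq]
      · refine congrArg Set.ncard (Set.ext fun w => ?_)
        simp only [Set.mem_union, Set.mem_ofPred_eq, ← or_and_right, em, true_and]
      · exact Set.disjoint_left.2 fun w h1 h2 => h2.1 h1.1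
    have h2 := hf j
    rw [hcompl] at h1
    omega
  have hWb : ∀ w, ι w ∈ W ↔ w ∈ W := by
    intro w
    have h1 : ∀ z, ι w = ι z ↔ w = z := fun z => bandVertex_injective.eq_iff
    have h2 : ∀ z, ι w = z ↔ w = ι z := fun z => by rw [← h1, hii]
    rw [hWmem, hWmem, h2 u, h2 v, h1, h1]
    tauto
  have hs := site_orderIso o hfW
  have hb := bandVertex_orderIso o hT hfW fun w hw _ => (hWb w).2 hw
  have hpu : Θ.pair (ι u) ∈ W := by
    rw [hWmem]
    rintro (h | h | h | h)
    · have : ι u = v := by rw [← Θ.pair_pair (ι u), h, huv]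
      exact hm (by rw [← hsu, this, hvs])
    · have : ι u = u := by rw [← Θ.pair_pair (ι u), h, hvu]
      exact hm (by rw [← hsu, this])
    · exact Θ.pair_ne _ h
    · exact hne h
  have hpv : Θ.pair (ι v) ∈ W := by
    rw [hWmem]
    rintro (h | h | h | h)
    · have : ι v = v := by rw [← Θ.pair_pair (ι v), h, huv]
      exact hm (by rw [← hsv, this, hvs])
    · have : ι v = u := by rw [← Θ.pair_pair (ι v), h, hvu]
      exact hm (by rw [← hsv, this])
    · exact hne (by rw [← h, Θ.pair_pair])
    · exact Θ.pair_ne _ h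
  have hpuv : Θ'.pair (o ⟨_, hpu⟩) = o ⟨_, hpv⟩ := ho _ _ (Or.inr ⟨rfl, rfl⟩)
  have hpvu : Θ'.pair (o ⟨_, hpv⟩) = o ⟨_, hpu⟩ := by rw [← hpuv, Θ'.pair_pair]
  -- Pairs of survivors are kept; the only survivors that lose their partner are those of `ι u` and
  -- `ι v`.
  have hcases : ∀ w : W, (∃ h : Θ.pair w ∈ W, Θ'.pair (o w) = o ⟨_, h⟩) ∨
      w = ⟨_, hpu⟩ ∨ w = ⟨_, hpv⟩ := by
    intro w
    by_cases h : Θ.pair w ∈ W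
    · exact Or.inl ⟨h, ho w ⟨_, h⟩ (Or.inl rfl)⟩
    · rw [hWmem, not_not] at h
      rcases h with h | h | h | h
      · exact absurd w.2 fun h' => (hWmem _).1 h' (Or.inr (Or.inl (by rw [← huv, ← h, Θ.pair_pair])))
      · exact absurd w.2 fun h' => (hWmem _).1 h' (Or.inl (by rw [← hvu, ← h, Θ.pair_pair]))
      · exact Or.inr (Or.inl (Subtype.ext ((Θ.pair_pair w.1).symm.trans (congrArg Θ.pair h))))
      · exact Or.inr (Or.inr (Subtype.ext ((Θ.pair_pair w.1).symm.trans (congrArg Θ.pair h))))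
  have hruv : Θ.curveGraph.Reachable u v := huv ▸ reachable_pair u
  have hru : Θ.curveGraph.Reachable u (ι u) := reachable_bandVertex hi
  have hrv : Θ.curveGraph.Reachable v (ι v) := reachable_bandVertex (hvs.symm ▸ hi)
  have hrp : Θ.curveGraph.Reachable (Θ.pair (ι u)) (Θ.pair (ι v)) :=
    (reachable_pair (ι u)).symm.trans (hru.symm.trans (hruv.trans (hrv.trans (reachable_pair _))))
  have hr : ∀ x y, Θ'.curveGraph.Reachable (o x) (o y) ↔ Θ.curveGraph.Reachable x.1 y.1 := by
    refine fun x y => ⟨fun h => ?_, fun h => ?_⟩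
    · refine reachable_iff.2 fun c hc hx => ?_
      suffices hinv : Θ'.IsInvariant fun w => c (o.symm w).1 by
        simpa using reachable_iff.1 h _ hinv (by simpa using hx)
      refine ⟨fun w hw => ?_, fun w hwi hw => ?_⟩
      · obtain ⟨z, rfl⟩ := o.surjective w
        rw [OrderIso.symm_apply_apply] at hw
        rcases hcases z with ⟨hz, h⟩ | rfl | rfl
        · rw [h, OrderIso.symm_apply_apply]
          exact hc.1 _ hw
        · rw [hpuv, OrderIso.symm_apply_apply]
          exact reachable_iff.1 hrp c hc hw
        · rw [hpvu, OrderIso.symm_apply_apply]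
          exact reachable_iff.1 hrp.symm c hc hw
      · obtain ⟨z, rfl⟩ := o.surjective w
        rw [hs] at hwi
        rw [hb z hwi]
        rw [OrderIso.symm_apply_apply] at hw ⊢
        exact hc.2 _ hwi hw
    · refine reachable_iff.2 fun c hc hx => ?_
      have hcp : c (o ⟨_, hpu⟩) ↔ c (o ⟨_, hpv⟩) :=
        ⟨fun h => hpuv ▸ hc.1 _ h, fun h => hpvu ▸ hc.1 _ h⟩
      -- The removed vertices get the truth value of the two newly paired ones, which agree by
      -- `hcp`.
      let d : Θ.frame.Vertex → Prop := fun w =>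
        if h : w ∈ W then c (o ⟨w, h⟩) else c (o ⟨_, hpu⟩)
      have hdW : ∀ w : W, d w ↔ c (o w) := fun w => by simp only [d, dif_pos w.2]
      have hdN : ∀ {w}, w ∉ W → (d w ↔ c (o ⟨_, hpu⟩)) := fun hw => by simp only [d, dif_neg hw]
      suffices hinv : Θ.IsInvariant d from (hdW y).1 (reachable_iff.1 h d hinv ((hdW x).2 hx))
      refine ⟨fun w hw => ?_, fun w hwi hw => ?_⟩
      · by_cases h : w ∈ W
        · have hw := (hdW ⟨w, h⟩).1 hw
          by_cases h' : Θ.pair w ∈ W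
          · refine (hdW ⟨_, h'⟩).2 ?_
            rw [← ho ⟨w, h⟩ ⟨_, h'⟩ (Or.inl rfl)]
            exact hc.1 _ hw
          · rw [hdN h']
            rcases hcases ⟨w, h⟩ with ⟨hz, _⟩ | hz | hz
            · exact absurd hz h'
            · rwa [hz] at hw
            · rwa [hz, ← hcp] at hw
        · replace hw := (hdN h).1 hw
          rw [hWmem, not_not] at h
          rcases h with rfl | rfl | rfl | rfl
          · rw [huv, hdN fun h => (hWmem _).1 h (Or.inr (Or.inl rfl))]
            exact hw
          · rw [hvu, hdN fun h => (hWmem _).1 h (Or.inl rfl)]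
            exact hw
          · exact (hdW ⟨_, hpu⟩).2 hw
          · exact (hdW ⟨_, hpv⟩).2 (hcp.1 hw)
      · by_cases h : w ∈ W
        · have hw := (hdW ⟨w, h⟩).1 hw
          refine (hdW ⟨_, (hWb w).2 h⟩).2 ?_
          rw [← hb ⟨w, h⟩ hwi]
          exact hc.2 _ (by rwa [hs]) hw
        · rw [hdN h] at hw
          rwa [hdN fun h' => h ((hWb w).1 h')]
  have hcount : ∀ (x : W) (j), (Θ.componentOf x).siteCount j = (Θ'.componentOf (o x)).siteCount j +
      if u ∈ (Θ.componentOf x).supp then if j = u.site ∨ j = Θ.frame.mate u.site then 2 else 0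
      else 0 := by
    intro x j
    have h1 : (Θ.componentOf x).siteCount j = (Θ'.componentOf (o x)).siteCount j +
        {w | w ∈ (Θ.componentOf x).supp ∧ w ∉ W ∧ w.site = j}.ncard := by
      rw [siteCount_componentOf_orderIso o hs hr, Component.siteCount, ← Set.ncard_union_eq]
      · refine congrArg Set.ncard (Set.ext fun w => ?_)
        simp only [Set.mem_union, Set.mem_ofPred_eq]
        tauto
      · exact Set.disjoint_left.2 fun w h1 h2 => h2.2.1 h1.1
    have hall : ∀ w ∉ W, Θ.curveGraph.Reachable u w := by
      intro w hw
      rw [hWmem, not_not] at hw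
      rcases hw with rfl | rfl | rfl | rfl
      exacts [SimpleGraph.Reachable.refl _, hruv, hru, hruv.trans hrv]
    rw [h1]
    congr 1
    split_ifs with hu hj
    · refine (congrArg Set.ncard (Set.ext fun w => and_iff_right_of_imp fun hw => ?_)).trans
        ((hcompl j).trans (if_pos hj))
      exact (componentOf_eq_iff.2 (hall w hw.1).symm).trans hu
    · refine Nat.le_zero.1 (((hcompl j).trans (if_neg hj)).symm ▸ Set.ncard_le_ncard ?_)
      exact fun w hw => hw.2
    · rw [Set.ncard_eq_zero (Set.toFinite _), Set.eq_empty_iff_forall_notMem]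
      rintro w ⟨hw, hwW, -⟩
      exact hu ((componentOf_eq_iff.2 (hall w hwW)).trans hw)
  refine weight_eq_prod (r := fun w => (o.symm w).1) (fun x y => ?_) (fun x => ?_) fun Γ hΓ => ?_
  · rw [← hr, OrderIso.apply_symm_apply, OrderIso.apply_symm_apply]
  · obtain ⟨y, rfl⟩ := o.surjective x
    rw [OrderIso.symm_apply_apply]
    refine factor_congr hT ?_ fun j => ?_
    · have hmi := (Θ.frame.isInner_mate_iff _).2 hi
      have hc : ∀ j, ¬ (j = u.site ∨ j = Θ.frame.mate u.site) →
          (Θ.componentOf y).siteCount j = (Θ'.componentOf (o y)).siteCount j := fun j hj => by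
        rw [hcount, if_neg hj, ite_self, add_zero]
      rw [Component.isInternal_iff, Component.isInternal_iff,
        hc 0 fun h => h.elim hi.1.symm hmi.1.symm, hc _ fun h => h.elim hi.2.symm hmi.2.symm]
    · rw [hcount]
      have : (2 : ZMod 2) = 0 := rfl
      split_ifs <;> simp [this]
  · exfalso
    obtain ⟨w, rfl⟩ := exists_componentOf Γ
    by_cases hw : w ∈ W
    · exact hΓ (o ⟨w, hw⟩) (by rw [OrderIso.symm_apply_apply])
    -- A component with a removed vertex also contains the surviving partner of `ι u`.
    · refine hΓ (o ⟨_, hpu⟩) ?_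
      rw [OrderIso.symm_apply_apply, componentOf_eq_iff]
      refine (reachable_pair (ι u)).symm.trans (hru.symm.trans ?_)
      rw [hWmem, not_not] at hw
      rcases hw with rfl | rfl | rfl | rfl
      exacts [SimpleGraph.Reachable.refl _, hruv, hru, hruv.trans hrv]

end Weight

end Datum

end SWB

/-! ### Invariance of the weight under handle slides -/

namespace SWB

namespace TwistedChordDatum

variable {N : ℕ} {T : TwistedChordDatum N}

/-- A set of sites containing exactly one element of every arc. -/
def IsTransversal (T : TwistedChordDatum N) (A : Finset (Fin (2 * N + 2))) : Prop :=
  ∀ j, (j ∈ A → IsInner j) ∧ (IsInner j → (T.mate j ∈ A ↔ j ∉ A))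

/-- The twist is summed over the smaller ends of the arcs, and a slide may change which end is
smaller. Any choice of ends gives the same sum. -/
theorem IsTransversal.sum_eq {A B : Finset (Fin (2 * N + 2))} (hA : T.IsTransversal A)
    (hB : T.IsTransversal B) {M : Type*} [AddCommMonoid M] {g : Fin (2 * N + 2) → M}
    (hg : ∀ j, g (T.mate j) = g j) : ∑ j ∈ A, g j = ∑ j ∈ B, g j := by
  have hmem : ∀ {A B : Finset (Fin (2 * N + 2))}, T.IsTransversal A → T.IsTransversal B →
      ∀ j ∈ A, (if j ∈ B then j else T.mate j) ∈ B := by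
    intro A B hA hB j hj
    split_ifs with h
    · exact h
    · exact ((hB j).2 ((hA j).1 hj)).2 h
  have hinv : ∀ {A B : Finset (Fin (2 * N + 2))}, T.IsTransversal A → T.IsTransversal B →
      ∀ j ∈ A, (if (if j ∈ B then j else T.mate j) ∈ A then (if j ∈ B then j else T.mate j)
        else T.mate (if j ∈ B then j else T.mate j)) = j := by
    intro A B hA hB j hj
    by_cases h : j ∈ B
    · simp only [if_pos h, if_pos hj]
    · have : T.mate j ∉ A := fun h' => ((hA j).2 ((hA j).1 hj)).1 h' hj
      simp only [if_neg h, if_neg this, T.mate_mate]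
  refine Finset.sum_nbij' (fun j => if j ∈ B then j else T.mate j)
    (fun j => if j ∈ A then j else T.mate j) (hmem hA hB) (hmem hB hA) (hinv hA hB) (hinv hB hA)
    fun j _ => ?_
  split_ifs
  · rfl
  · exact (hg j).symm

theorem IsTransversal.sum_arc {A : Finset (Fin (2 * N + 2))} (hA : T.IsTransversal A)
    {M : Type*} [AddCommMonoid M] {a : Fin (2 * N + 2)} (ha : IsInner a) (c : M) :
    ∑ j ∈ A, (if j = a ∨ j = T.mate a then c else 0) = c := by
  have h := (hA a).2 ha
  by_cases haA : a ∈ A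
  · rw [Finset.sum_eq_single_of_mem a haA, if_pos (Or.inl rfl)]
    intro j hj hja
    exact if_neg fun h' => h'.elim hja fun hjm => h.1 (hjm ▸ hj) haA
  · rw [Finset.sum_eq_single_of_mem (T.mate a) (h.2 haA), if_pos (Or.inr rfl)]
    intro j hj hja
    exact if_neg fun h' => h'.elim (fun hjm => haA (hjm ▸ hj)) hja

theorem isTransversal_filter (T : TwistedChordDatum N) {L : Type*} [LinearOrder L]
    {g : Fin (2 * N + 2) → L} (hg : Function.Injective g) :
    T.IsTransversal (Finset.univ.filter fun j => g j < g (T.mate j)) := by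
  intro j
  simp only [Finset.mem_filter, Finset.mem_univ, true_and, T.mate_mate, not_lt]
  refine ⟨fun h => (T.isInner_iff_mate_ne j).2 fun h' => by simp [h'] at h, fun h => ?_⟩
  have := hg.ne ((T.isInner_iff_mate_ne j).1 h)
  exact ⟨le_of_lt, fun h => lt_of_le_of_ne h this⟩

end TwistedChordDatum

namespace Datum

open SWB.Frame

variable {N n m : ℕ} {Θ Θ' : Datum N n m}

/-- The properties of the relabelling `o` of vertices under a handle slide which determine the
components of the new curve graph. -/
structure IsSlideMap (Θ Θ' : Datum N n m) (i k : Fin (2 * N + 2))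
    (σ : Equiv.Perm (Fin (2 * N + 2))) (o : Θ.frame.Vertex → Θ'.frame.Vertex) : Prop where
  inner_site : IsInner i
  inner_next : IsInner k
  ne : i ≠ k
  not_mate : Θ.frame.mate i ≠ k
  perm_zero : σ 0 = 0
  perm_last : σ (Fin.last (2 * N + 1)) = Fin.last (2 * N + 1)
  mate_eq : ∀ j, Θ'.frame.mate (σ j) = σ (Θ.frame.mate j)
  twist_eq : ∀ j, Θ'.frame.twist (σ j) =
    Θ.frame.twist j + if j = i ∨ j = Θ.frame.mate i then Θ.frame.twist k else 0
  injective : Function.Injective o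
  site_eq : ∀ x, (o x).site = if x.site = i then σ k else σ x.site
  pair_eq : ∀ x, Θ'.pair (o x) = o (Θ.pair x)
  band_eq : ∀ x, IsInner x.site → x.site ≠ i → x.site ≠ Θ.frame.mate i →
    Θ'.frame.bandVertex (o x) = o (Θ.frame.bandVertex x)
  pair_band : ∀ x, x.site = i →
    Θ'.pair (Θ'.frame.bandVertex (o x)) = Θ'.frame.bandVertex (o (Θ.frame.bandVertex x))
  exhausts : ∀ v, (∃ x, v = o x) ∨
    ∃ x, (x.site = i ∨ x.site = Θ.frame.mate i) ∧ v = Θ'.frame.bandVertex (o x)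
  not_range : ∀ x y, (x.site = i ∨ x.site = Θ.frame.mate i) → o y ≠ Θ'.frame.bandVertex (o x)

theorem _root_.SWB.isInner_perm_iff {N : ℕ} {σ : Equiv.Perm (Fin (2 * N + 2))} (h0 : σ 0 = 0)
    (hl : σ (Fin.last (2 * N + 1)) = Fin.last (2 * N + 1)) (j : Fin (2 * N + 2)) :
    IsInner (σ j) ↔ IsInner j := by
  have h1 : σ j = 0 ↔ j = 0 := by rw [← σ.injective.eq_iff (a := j), h0]
  have h2 : σ j = Fin.last _ ↔ j = Fin.last _ := by rw [← σ.injective.eq_iff (a := j), hl]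
  rw [IsInner, IsInner, Ne, Ne, h1, h2]

namespace IsSlideMap

variable {i k : Fin (2 * N + 2)} {σ : Equiv.Perm (Fin (2 * N + 2))}
  {o : Θ.frame.Vertex → Θ'.frame.Vertex}

theorem isInner_perm (h : IsSlideMap Θ Θ' i k σ o) (j : Fin (2 * N + 2)) :
    IsInner (σ j) ↔ IsInner j :=
  isInner_perm_iff h.perm_zero h.perm_last j

theorem isInner_site (h : IsSlideMap Θ Θ' i k σ o) (x : Θ.frame.Vertex) :
    IsInner (o x).site ↔ IsInner x.site := by
  rw [h.site_eq]
  split_ifs with hx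
  · rw [h.isInner_perm, hx]
    exact iff_of_true h.inner_next h.inner_site
  · exact h.isInner_perm _

theorem pair_band' (h : IsSlideMap Θ Θ' i k σ o) (x : Θ.frame.Vertex)
    (hx : x.site = i ∨ x.site = Θ.frame.mate i) :
    Θ'.pair (Θ'.frame.bandVertex (o x)) = Θ'.frame.bandVertex (o (Θ.frame.bandVertex x)) := by
  rcases hx with hx | hx
  · exact h.pair_band x hx
  · have := h.pair_band (Θ.frame.bandVertex x) (by rw [site_bandVertex, hx, Θ.frame.mate_mate])
    rw [bandVertex_bandVertex] at this
    rw [← this, Θ'.pair_pair]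

theorem reachable_band (h : IsSlideMap Θ Θ' i k σ o) (x : Θ.frame.Vertex) (hx : IsInner x.site) :
    Θ'.curveGraph.Reachable (o x) (o (Θ.frame.bandVertex x)) := by
  have h1 := reachable_bandVertex ((h.isInner_site x).2 hx)
  have h2 := reachable_bandVertex
    ((h.isInner_site (Θ.frame.bandVertex x)).2 ((Θ.frame.isInner_mate_iff _).2 hx))
  by_cases hi : x.site = i ∨ x.site = Θ.frame.mate i
  · refine h1.trans ((reachable_pair _).trans ?_)
    rw [h.pair_band' x hi]
    exact h2.symm
  · rw [not_or] at hi
    rwa [h.band_eq x hx hi.1 hi.2] at h1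

theorem reachable_iff (h : IsSlideMap Θ Θ' i k σ o) (x y : Θ.frame.Vertex) :
    Θ.curveGraph.Reachable x y ↔ Θ'.curveGraph.Reachable (o x) (o y) := by
  constructor
  · intro hxy
    refine Datum.reachable_iff.1 hxy (fun z => Θ'.curveGraph.Reachable (o x) (o z))
      ⟨fun u hu => hu.trans ?_, fun u hi hu => hu.trans (h.reachable_band u hi)⟩
      (SimpleGraph.Reachable.refl _)
    rw [← h.pair_eq]
    exact reachable_pair _
  · intro hxy
    refine Datum.reachable_iff.2 fun c hc hx => ?_
    -- The images of the vertices of the old component, together with the vertices on the detours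
    -- that replace its strands in the band at `i`.
    let d : Θ'.frame.Vertex → Prop := fun v => ∃ x, c x ∧ (v = o x ∨
      (x.site = i ∨ x.site = Θ.frame.mate i) ∧ v = Θ'.frame.bandVertex (o x))
    suffices hinv : Θ'.IsInvariant d by
      obtain ⟨z, hz, hyz | ⟨hzi, hyz⟩⟩ := Datum.reachable_iff.1 hxy d hinv ⟨x, hx, Or.inl rfl⟩
      · exact h.injective hyz ▸ hz
      · exact absurd hyz (h.not_range z y hzi)
    have hmate : ∀ {z : Θ.frame.Vertex}, (z.site = i ∨ z.site = Θ.frame.mate i) →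
        IsInner z.site ∧ ((Θ.frame.bandVertex z).site = i ∨
          (Θ.frame.bandVertex z).site = Θ.frame.mate i) := by
      rintro z (hz | hz)
      · exact ⟨hz ▸ h.inner_site, Or.inr (by rw [site_bandVertex, hz])⟩
      · exact ⟨hz ▸ (Θ.frame.isInner_mate_iff _).2 h.inner_site,
          Or.inl (by rw [site_bandVertex, hz, Θ.frame.mate_mate])⟩
    refine ⟨?_, ?_⟩
    · rintro _ ⟨z, hz, rfl | ⟨hzi, rfl⟩⟩
      · exact ⟨Θ.pair z, hc.1 z hz, Or.inl (h.pair_eq z)⟩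
      · exact ⟨Θ.frame.bandVertex z, hc.2 z (hmate hzi).1 hz,
          Or.inr ⟨(hmate hzi).2, h.pair_band' z hzi⟩⟩
    · rintro _ hi ⟨z, hz, rfl | ⟨hzi, rfl⟩⟩
      · rw [h.isInner_site] at hi
        by_cases hzi : z.site = i ∨ z.site = Θ.frame.mate i
        · exact ⟨z, hz, Or.inr ⟨hzi, rfl⟩⟩
        · rw [not_or] at hzi
          exact ⟨_, hc.2 z hi hz, Or.inl (h.band_eq z hi hzi.1 hzi.2)⟩
      · exact ⟨z, hz, Or.inl (bandVertex_bandVertex _)⟩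

/-- New vertices lie only at `σ i` and `σ (mate k)`. Elsewhere only images are counted, and those
from `i` have moved to `σ k`. -/
theorem siteCount_of_ne (h : IsSlideMap Θ Θ' i k σ o) (x : Θ.frame.Vertex) {j : Fin (2 * N + 2)}
    (hji : j ≠ i) (hjk : j ≠ Θ.frame.mate k) :
    (Θ'.componentOf (o x)).siteCount (σ j) =
      (Θ.componentOf x).siteCount j + if j = k then (Θ.componentOf x).siteCount i else 0 := by
  have h1 : {v | v ∈ (Θ'.componentOf (o x)).supp ∧ v.site = σ j} =
      o '' {y | y ∈ (Θ.componentOf x).supp ∧ (o y).site = σ j} := by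
    ext v
    simp only [Set.mem_image, Set.mem_ofPred_eq, mem_supp_iff]
    constructor
    · rintro ⟨hv, hs⟩
      rcases h.exhausts v with ⟨y, rfl⟩ | ⟨y, hy, rfl⟩
      · exact ⟨y, ⟨componentOf_eq_iff.2 ((h.reachable_iff _ _).2 (componentOf_eq_iff.1 hv)), hs⟩,
          rfl⟩
      · exfalso
        rw [site_bandVertex, h.site_eq] at hs
        split_ifs at hs with hyi
        · rw [h.mate_eq] at hs
          exact hjk (σ.injective hs).symm
        · rw [hy.resolve_left hyi, h.mate_eq, Θ.frame.mate_mate] at hs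
          exact hji (σ.injective hs).symm
    · rintro ⟨y, ⟨hy, hs⟩, rfl⟩
      exact ⟨componentOf_eq_iff.2 ((h.reachable_iff _ _).1 (componentOf_eq_iff.1 hy)), hs⟩
  rw [Component.siteCount, h1, Set.ncard_image_of_injective _ h.injective, Component.siteCount]
  simp only [h.site_eq]
  split_ifs with hj
  · subst hj
    rw [Component.siteCount, ← Set.ncard_union_eq]
    · refine congrArg Set.ncard (Set.ext fun y => ?_)
      simp only [Set.mem_union, Set.mem_ofPred_eq, ← and_or_left]
      refine and_congr_right fun _ => ?_
      split_ifs with hy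
      · exact iff_of_true rfl (Or.inr hy)
      · rw [σ.injective.eq_iff]
        exact (or_iff_left hy).symm
    · exact Set.disjoint_left.2 fun y h1 h2 => hji (h1.2.symm.trans h2.2)
  · rw [add_zero]
    refine congrArg Set.ncard (Set.ext fun y => and_congr_right fun _ => ?_)
    split_ifs with hy
    · rw [σ.injective.eq_iff]
      exact iff_of_false (Ne.symm hj) fun h' => hji (h'.symm.trans hy)
    · rw [σ.injective.eq_iff]

theorem siteCount_eq (h : IsSlideMap Θ Θ' i k σ o) (x : Θ.frame.Vertex) (j : Fin (2 * N + 2)) :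
    (Θ'.componentOf (o x)).siteCount (σ j) = (Θ.componentOf x).siteCount j +
      if j = k ∨ j = Θ.frame.mate k then (Θ.componentOf x).siteCount i else 0 := by
  have hki := (Θ.frame.isInner_iff_mate_ne k).1 h.inner_next
  have hii := (Θ.frame.isInner_iff_mate_ne i).1 h.inner_site
  have hmk : Θ.frame.mate k ≠ i := fun h' => h.not_mate (by rw [← h', Θ.frame.mate_mate])
  by_cases hji : j = i
  · subst hji
    -- The excluded sites `i` and `mate k` are counted at the other ends of their bands.
    have h1 := h.siteCount_of_ne x hii (Θ.frame.mate_injective.ne h.ne)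
    rw [if_neg h.not_mate, ← h.mate_eq, Component.siteCount_mate, Component.siteCount_mate] at h1
    rw [h1, if_neg fun h' => h'.elim h.ne hmk.symm]
  · by_cases hjk : j = Θ.frame.mate k
    · have h1 := h.siteCount_of_ne x h.ne.symm hki.symm
      rw [if_pos rfl] at h1
      rw [hjk, ← h.mate_eq, Component.siteCount_mate, Component.siteCount_mate, h1,
        if_pos (Or.inr rfl)]
    · rw [h.siteCount_of_ne x hji hjk]
      simp only [hjk, or_false]

/-- The arc of `k` gains the strands of `i`, and the arc of `i` gains the twist of `k`. Both add the
count at `i` times the twist of `k`, which cancels modulo 2. -/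
theorem twist_componentOf (h : IsSlideMap Θ Θ' i k σ o) (x : Θ.frame.Vertex) :
    (Θ'.componentOf (o x)).twist = (Θ.componentOf x).twist := by
  classical
  have hmk : Θ.frame.mate k ≠ i := fun h' => h.not_mate (by rw [← h', Θ.frame.mate_mate])
  set T := Θ.frame.toTwistedChordDatum
  set t : Fin (2 * N + 2) → ZMod 2 := fun j => (Θ.componentOf x).siteCount j * T.twist j with ht
  have hA := T.isTransversal_filter (g := id) Function.injective_id
  have hB := T.isTransversal_filter (g := σ) σ.injective
  have h1 : (Θ.componentOf x).twist = ∑ j with id j < id (T.mate j), t j := by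
    rw [Finset.sum_filter]
    rfl
  have h2 : (Θ'.componentOf (o x)).twist = ∑ j with σ j < σ (T.mate j),
      ((Θ'.componentOf (o x)).siteCount (σ j) : ZMod 2) * Θ'.frame.twist (σ j) := by
    rw [Finset.sum_filter]
    simp only [T, ← h.mate_eq]
    exact (Equiv.sum_comp σ fun j => if j < Θ'.frame.mate j then
      ((Θ'.componentOf (o x)).siteCount j : ZMod 2) * Θ'.frame.twist j else 0).symm
  have h3 : ∀ j, ((Θ'.componentOf (o x)).siteCount (σ j) : ZMod 2) * Θ'.frame.twist (σ j) =
      t j + ((if j = k ∨ j = T.mate k then (Θ.componentOf x).siteCount i * T.twist k else 0) +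
        if j = i ∨ j = T.mate i then (Θ.componentOf x).siteCount i * T.twist k else 0) := by
    intro j
    rw [h.siteCount_eq, h.twist_eq]
    by_cases hj : j = k ∨ j = Θ.frame.mate k
    · have hji : ¬ (j = i ∨ j = Θ.frame.mate i) := by
        rcases hj with rfl | rfl
        · exact fun h' => h'.elim h.ne.symm h.not_mate.symm
        · exact fun h' => h'.elim hmk fun h' => h.ne (Θ.frame.mate_injective h').symm
      have htk : Θ.frame.twist j = Θ.frame.twist k := by
        rcases hj with rfl | rfl
        · rfl
        · exact Θ.frame.twist_mate k
      simp only [ht, T, if_pos hj, if_neg hji, htk]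
      push_cast
      ring
    · by_cases hji : j = i ∨ j = Θ.frame.mate i
      · have hc : (Θ.componentOf x).siteCount j = (Θ.componentOf x).siteCount i := by
          rcases hji with rfl | rfl
          · rfl
          · exact Component.siteCount_mate _ _
        simp only [ht, T, if_neg hj, if_pos hji, hc]
        push_cast
        ring
      · simp only [ht, T, if_neg hj, if_neg hji]
        push_cast
        ring
  rw [h1, h2, Finset.sum_congr rfl fun j _ => h3 j, Finset.sum_add_distrib, Finset.sum_add_distrib,
    hB.sum_arc h.inner_next, hB.sum_arc h.inner_site, CharTwo.add_self_eq_zero, add_zero]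
  refine hB.sum_eq hA fun j => ?_
  simp only [ht]
  rw [T.twist_mate]
  congr 2
  exact Component.siteCount_mate _ _

theorem weight_eq (h : IsSlideMap Θ Θ' i k σ o) {K : Type*} [CommRing K] (α β γ : K) :
    Θ.weight α β γ = Θ'.weight α β γ := by
  classical
  have hmk : Θ.frame.mate k ≠ i := fun h' => h.not_mate (by rw [← h', Θ.frame.mate_mate])
  have hkm := (Θ.frame.isInner_mate_iff _).2 h.inner_next
  refine weight_eq_prod h.reachable_iff (fun x => ?_) fun Γ hΓ => ?_
  · have hin : (Θ.componentOf x).IsInternal ↔ (Θ'.componentOf (o x)).IsInternal := by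
      have h0 := h.siteCount_eq x 0
      have hl := h.siteCount_eq x (Fin.last _)
      rw [h.perm_zero, if_neg fun h' => h'.elim h.inner_next.1.symm hkm.1.symm, add_zero] at h0
      rw [h.perm_last, if_neg fun h' => h'.elim h.inner_next.2.symm hkm.2.symm, add_zero] at hl
      rw [Component.isInternal_iff, Component.isInternal_iff, h0, hl]
    have heven : (∀ j, Even ((Θ.componentOf x).siteCount j)) ↔
        ∀ j, Even ((Θ'.componentOf (o x)).siteCount j) := by
      rw [← σ.forall_congr_right (q := fun j => Even ((Θ'.componentOf (o x)).siteCount j))]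
      simp only [h.siteCount_eq]
      constructor
      · intro he j
        split_ifs
        · exact (he j).add (he i)
        · exact he j
      · intro he
        -- The count at `i` is unchanged by the slide; its parity is known first and can be
        -- subtracted at the arc of `k`.
        have hi := he i
        rw [if_neg fun h' => h'.elim h.ne hmk.symm, add_zero] at hi
        intro j
        have hj := he j
        split_ifs at hj
        · exact (Nat.even_add.1 hj).2 hi
        · exact hj
    simp only [Component.factor, heven, h.twist_componentOf]
    exact if_congr hin rfl rfl
  · exfalso
    obtain ⟨v, rfl⟩ := exists_componentOf Γ
    rcases h.exhausts v with ⟨x, rfl⟩ | ⟨x, hx, rfl⟩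
    · exact hΓ x rfl
    · refine hΓ x (componentOf_eq_iff.2 (reachable_bandVertex ((h.isInner_site x).2 ?_)))
      rcases hx with hx | hx
      · exact hx ▸ h.inner_site
      · exact hx ▸ (Θ.frame.isInner_mate_iff _).2 h.inner_site

end IsSlideMap

end Datum

end SWB

/-! ### Reading off the relabelling from a handle slide -/

namespace SWB

namespace Datum

open SWB.Frame

variable {N n m : ℕ} {Θ Θ' : Datum N n m}

/-- The definition fixes only the place of `U`, the order and the pairing. Where old vertices go,
and how they pass through bands, then follows by counting and rigidity. -/
theorem IsHandleSlide.exists_isSlideMap (h : Θ.IsHandleSlide Θ') :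
    ∃ i k σ o, IsSlideMap Θ Θ' i k σ o := by
  classical
  obtain ⟨i, k, ε, σ, hC, hf, U, o, -, hU, hUi, hUik, hrange, hpair, hband⟩ := h
  have hε : (ε : ℤ) = 1 ∨ (ε : ℤ) = -1 := by
    rcases Int.units_eq_one_or ε with rfl | rfl
    · exact Or.inl rfl
    · exact Or.inr rfl
  have hnext := hC.next_eq
  have hik : i ≠ k := by
    rintro rfl
    omega
  have hmate : ∀ j, Θ'.frame.mate (σ j) = σ (Θ.frame.mate j) := hC.mate_eq
  have hmi : Θ.frame.mate i ≠ k := hC.not_mate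
  have hmk : Θ.frame.mate k ≠ i := fun h' => hmi (by rw [← h', Θ.frame.mate_mate])
  have hii := (Θ.frame.isInner_iff_mate_ne i).1 hC.inner_site
  have hkk := (Θ.frame.isInner_iff_mate_ne k).1 hC.inner_next
  have hinner := isInner_perm_iff hC.perm_zero hC.perm_last
  have hmono : ∀ {a b}, a ≠ i → b ≠ i → a ≤ b → σ a ≤ σ b := fun ha hb hab =>
    hC.perm_mono.monotoneOn ha hb hab
  have hUrange : ∀ v, v ∉ U ↔ ∃ x, o x = v := fun v => by
    rw [← Set.mem_compl_iff, ← hrange, Set.mem_range]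
  have hoU : ∀ x, o x ∉ U := fun x => (hUrange _).2 ⟨x, rfl⟩
  have hfi : Θ'.frame.f (σ i) = Θ.frame.f i := by
    rw [hf, if_neg fun h' => h'.elim hik hmk.symm, add_zero]
  -- the new vertices at the site of the mate of `k`
  have hUk : {v | v ∈ U ∧ v.site = σ (Θ.frame.mate k)}.ncard = Θ.frame.f i := by
    have h1 : U = {v | v.site = σ i} ∪ {v | v ∈ U ∧ v.site = σ (Θ.frame.mate k)} := by
      ext v
      refine ⟨fun hv => (hUik hv).imp id fun h => ⟨hv, h⟩, ?_⟩
      rintro (hv | hv)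
      · exact hUi hv
      · exact hv.1
    have h2 : U.ncard = Θ.frame.f i + {v | v ∈ U ∧ v.site = σ (Θ.frame.mate k)}.ncard := by
      conv_lhs => rw [h1]
      rw [Set.ncard_union_eq, ncard_site, hfi]
      exact Set.disjoint_left.2 fun v h1 h2 => hmk (σ.injective (h2.2.symm.trans h1))
    omega
  -- Old vertices at `i` join those at the neighbour `k`. Collapsing `i` to `k` keeps the site map
  -- monotone, because no site lies between them.
  have hsite : ∀ x, (o x).site = if x.site = i then σ k else σ x.site := by
    refine congrFun (eq_of_monotone_of_ncard_fiber_eq (p := fun x => (o x).site)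
      (q := fun x : Θ.frame.Vertex => if x.site = i then σ k else σ x.site)
      (site_monotone.comp o.monotone) (fun x y hxy => ?_) fun l => ?_)
    · have hxy := site_monotone hxy
      simp only
      split_ifs with hx hy hy
      · exact le_rfl
      · refine hmono hik.symm hy ?_
        have h1 : (x.site : ℕ) ≤ y.site := hxy
        have h2 : (y.site : ℕ) ≠ i := fun h' => hy (Fin.ext h')
        rw [hx] at h1
        rw [Fin.le_def]
        omega
      · refine hmono hx hik.symm ?_
        have h1 : (x.site : ℕ) ≤ y.site := hxy
        have h2 : (x.site : ℕ) ≠ i := fun h' => hx (Fin.ext h')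
        rw [hy] at h1
        rw [Fin.le_def]
        omega
      · exact hmono hx hy hxy
    · obtain ⟨j, rfl⟩ := σ.surjective l
      have h1 : {x | (o x).site = σ j}.ncard + {v | v ∈ U ∧ v.site = σ j}.ncard =
          Θ'.frame.f (σ j) := by
        rw [← ncard_site, ← Set.ncard_image_of_injective _ o.injective, ← Set.ncard_union_eq]
        · refine congrArg Set.ncard (Set.ext fun v => ?_)
          simp only [Set.mem_union, Set.mem_image, Set.mem_ofPred_eq]
          constructor
          · rintro (⟨x, hx, rfl⟩ | hv)
            · exact hx
            · exact hv.2
          · intro hv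
            by_cases hvU : v ∈ U
            · exact Or.inr ⟨hvU, hv⟩
            · obtain ⟨x, rfl⟩ := (hUrange v).1 hvU
              exact Or.inl ⟨x, hv, rfl⟩
        · rw [Set.disjoint_left]
          rintro _ ⟨x, -, rfl⟩ hx
          exact hoU x hx.1
      have h2 : {v | v ∈ U ∧ v.site = σ j}.ncard =
          if j = i ∨ j = Θ.frame.mate k then Θ.frame.f i else 0 := by
        split_ifs with hj
        · rcases hj with rfl | rfl
          · rw [← hfi, ← ncard_site]
            exact congrArg Set.ncard (Set.ext fun v => and_iff_right_of_imp fun hv => hUi hv)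
          · exact hUk
        · rw [Set.ncard_eq_zero (Set.toFinite _), Set.eq_empty_iff_forall_notMem]
          rintro v ⟨hv, hs⟩
          refine hj ((hUik hv).imp (fun h => ?_) fun h => ?_)
          · exact σ.injective (hs.symm.trans h)
          · exact σ.injective (hs.symm.trans h)
      have h3 : {x : Θ.frame.Vertex | (if x.site = i then σ k else σ x.site) = σ j}.ncard =
          (if j = i then 0 else Θ.frame.f j) + if j = k then Θ.frame.f i else 0 := by
        have h4 : {x : Θ.frame.Vertex | (if x.site = i then σ k else σ x.site) = σ j} =
            {x | x.site = j ∧ j ≠ i} ∪ {x | x.site = i ∧ j = k} := by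
          ext x
          simp only [Set.mem_union, Set.mem_ofPred_eq]
          split_ifs with hx
          · rw [σ.injective.eq_iff]
            constructor
            · exact fun h => Or.inr ⟨hx, h.symm⟩
            · rintro (h | h)
              · exact absurd (h.1.symm.trans hx) h.2
              · exact h.2.symm
          · rw [σ.injective.eq_iff]
            constructor
            · exact fun h => Or.inl ⟨h, h ▸ hx⟩
            · rintro (h | h)
              · exact h.1
              · exact absurd h.1 hx
        rw [h4, Set.ncard_union_eq]
        · congr 1
          · split_ifs with hj
            · simp [hj]
            · simp [hj, ncard_site]
          · split_ifs with hj
            · simp [hj, ncard_site]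
            · simp [hj]
        · exact Set.disjoint_left.2 fun x h1 h2 => h1.2 (h1.1.symm.trans h2.1)
      rw [h2, hf] at h1
      rw [h3]
      by_cases hji : j = i
      · subst hji
        rw [if_pos (Or.inl rfl), if_neg fun h' => h'.elim hik hmk.symm] at h1
        rw [if_pos rfl, if_neg hik]
        omega
      · by_cases hjk : j = k
        · subst hjk
          rw [if_neg fun h' => h'.elim hji hkk.symm, if_pos (Or.inl rfl)] at h1
          rw [if_neg hji, if_pos rfl]
          omega
        · rw [if_neg hji, if_neg hjk]
          by_cases hjm : j = Θ.frame.mate k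
          · rw [if_pos (Or.inr hjm), if_pos (Or.inr hjm)] at h1
            omega
          · rw [if_neg fun h' => h'.elim hji hjm, if_neg fun h' => h'.elim hjk hjm] at h1
            omega
  have hsite_i : ∀ {x}, x.site = i → (o x).site = σ k := fun {x} hx => by rw [hsite, if_pos hx]
  have hsite_ne : ∀ {x}, x.site ≠ i → (o x).site = σ x.site := fun {x} hx => by
    rw [hsite, if_neg hx]
  have hpairU : ∀ v, Θ'.pair v ∈ U → v ∈ U := by
    intro v hv
    by_contra hvU
    obtain ⟨x, rfl⟩ := (hUrange v).1 hvU
    rw [hpair] at hv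
    exact hoU _ hv
  have hbmi : ∀ x, x.site = Θ.frame.mate i → Θ'.frame.bandVertex (o x) ∈ U := by
    intro x hx
    refine hUi ?_
    change (Θ'.frame.bandVertex (o x)).site = σ i
    rw [site_bandVertex, hsite_ne (hx ▸ hii), hx, hmate, Θ.frame.mate_mate]
  -- The partner of this vertex lies at `σ i`, hence in `U`, and `U` is closed under pairing.
  have hbi : ∀ x, x.site = i → Θ'.frame.bandVertex (o x) ∈ U := by
    intro x hx
    refine hpairU _ ?_
    rw [hband x hx]
    exact hbmi _ (by rw [site_bandVertex, hx])
  -- The left side lies in the right one, and both have `f i` elements.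
  have hUk_image : (fun x => Θ'.frame.bandVertex (o x)) '' {x | x.site = i} =
      {v | v ∈ U ∧ v.site = σ (Θ.frame.mate k)} := by
    refine Set.eq_of_subset_of_ncard_le ?_ ?_ (Set.toFinite _)
    · rintro _ ⟨x, hx, rfl⟩
      exact ⟨hbi x hx, by simp only [site_bandVertex, hsite_i hx, hmate]⟩
    · have hinj : Function.Injective fun x => Θ'.frame.bandVertex (o x) :=
        bandVertex_injective.comp o.injective
      rw [hUk, Set.ncard_image_of_injective _ hinj, ncard_site]
  have hUk_exists : ∀ v ∈ U, v.site = σ (Θ.frame.mate k) → ∃ x, x.site = i ∧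
      Θ'.frame.bandVertex (o x) = v := fun v hv hs => by
    obtain ⟨x, hx, hxv⟩ := hUk_image.symm.subset (show v ∈ {v | _} from ⟨hv, hs⟩)
    exact ⟨x, hx, hxv⟩
  have hfi_image : ∀ v, v.site = σ i → ∃ x, x.site = Θ.frame.mate i ∧
      v = Θ'.frame.bandVertex (o x) := by
    intro v hv
    have hs : (Θ'.frame.bandVertex v).site = σ (Θ.frame.mate i) := by
      rw [site_bandVertex, hv, hmate]
    obtain ⟨x, hx⟩ := (hUrange (Θ'.frame.bandVertex v)).1 fun hvU => by
      rcases hUik hvU with h | h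
      · exact hii (σ.injective (hs.symm.trans h))
      · exact hik (Θ.frame.mate_injective (σ.injective (hs.symm.trans h)))
    refine ⟨x, ?_, by rw [hx, bandVertex_bandVertex]⟩
    rw [← hx] at hs
    by_cases hxi : x.site = i
    · rw [hsite_i hxi] at hs
      exact absurd (σ.injective hs).symm hmi
    · rw [hsite_ne hxi] at hs
      exact σ.injective hs
  have htw : ∀ j, Θ'.frame.twist (σ j) =
    Θ.frame.twist j + if j = i ∨ j = Θ.frame.mate i then Θ.frame.twist k else 0 := hC.twist_eq
  -- the bands other than the one at `i`, away from the mate of `k`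
  have hbe : ∀ x, IsInner x.site → x.site ≠ i → x.site ≠ Θ.frame.mate i →
      x.site ≠ Θ.frame.mate k → Θ'.frame.bandVertex (o x) = o (Θ.frame.bandVertex x) := by
    intro x hx hxi hxm hxk
    refine bandVertex_comm (r := id) (τ := Θ.frame.bandVertex) strictMono_id o.strictMono
      (fun _ _ => rfl) hx ((hinner _).2 hx) (by rw [htw, if_neg (not_or.2 ⟨hxi, hxm⟩), add_zero])
      (fun y hy => ?_) (fun y hy => ?_) rfl
    · replace hy : y.site = x.site := hy
      rw [hsite_ne (hy ▸ hxi), hy]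
    · replace hy : y.site = x.site := hy
      have hs : (Θ'.frame.bandVertex (o y)).site = σ (Θ.frame.mate x.site) := by
        rw [site_bandVertex, hsite_ne (hy ▸ hxi), hmate, hy]
      have hmx : Θ.frame.mate x.site ≠ i := fun h => hxm (by rw [← h, Θ.frame.mate_mate])
      obtain ⟨w, hw⟩ := (hUrange (Θ'.frame.bandVertex (o y))).1 fun hvU => by
        rcases hUik hvU with h | h
        · exact hmx (σ.injective (hs.symm.trans h))
        · obtain ⟨z, hz, hzy⟩ := hUk_exists _ hvU h
          have hzy := o.injective (bandVertex_injective hzy)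
          exact hxi (hy.symm.trans (hzy ▸ hz))
      rw [← hw] at hs
      have hws : w.site = Θ.frame.mate x.site := by
        by_cases hwi : w.site = i
        · rw [hsite_i hwi] at hs
          exact absurd (by rw [σ.injective hs, Θ.frame.mate_mate]) hxk
        · rw [hsite_ne hwi] at hs
          exact σ.injective hs
      refine ⟨Θ.frame.bandVertex w, ?_, by rw [bandVertex_bandVertex, hw]⟩
      change (Θ.frame.bandVertex w).site = _
      rw [site_bandVertex, hws, Θ.frame.mate_mate]
  refine ⟨i, k, σ, o, hC.inner_site, hC.inner_next, hik, hmi, hC.perm_zero, hC.perm_last, hmate, htw,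
    o.injective, hsite, hpair, fun x hx hxi hxm => ?_, hband, fun v => ?_, fun x y hx hxy => ?_⟩
  -- Vertices at `σ k` come from `k` and from `i`, so the rigidity argument does not start from
  -- `mate k`; that end is obtained from `k` by the involution.
  · by_cases hxk : x.site = Θ.frame.mate k
    · have hs : (Θ.frame.bandVertex x).site = k := by
        rw [site_bandVertex, hxk, Θ.frame.mate_mate]
      have h1 := hbe (Θ.frame.bandVertex x) (hs ▸ hC.inner_next) (hs ▸ hik.symm)
        (hs ▸ hmi.symm) (hs ▸ hkk.symm)
      rw [bandVertex_bandVertex] at h1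
      rw [← h1, bandVertex_bandVertex]
    · exact hbe x hx hxi hxm hxk
  · by_cases hv : v ∈ U
    · right
      rcases hUik hv with h | h
      · obtain ⟨x, hx, rfl⟩ := hfi_image v h
        exact ⟨x, Or.inr hx, rfl⟩
      · obtain ⟨x, hx, rfl⟩ := hUk_exists v hv h
        exact ⟨x, Or.inl hx, rfl⟩
    · obtain ⟨x, rfl⟩ := (hUrange v).1 hv
      exact Or.inl ⟨x, rfl⟩
  · refine hoU y (hxy ▸ ?_)
    exact hx.elim (hbi x) (hbmi x)

end Datum

/-! ### The weight as a linear form on morphisms -/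

section Morphisms

variable {K : Type*} [CommRing K] (α β γ : K) {n m : ℕ}

theorem Isotopic.weight_eq {x y : Sq n m} (h : Isotopic x y) :
    x.2.weight α β γ = y.2.weight α β γ := by
  induction h with
  | rel x y h =>
    obtain ⟨N, Θ, Θ', rfl, rfl, h⟩ := h
    exact (Datum.weight_of_isPullThrough h).symm
  | refl => rfl
  | symm _ _ _ ih => exact ih.symm
  | trans _ _ _ _ _ ih1 ih2 => exact ih1.trans ih2

theorem weight_eq_of_handleSlide {x y : Sq n m} (h : (handleSlideSetoid n m).r x y) :
    x.2.weight α β γ = y.2.weight α β γ := by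
  change Relation.EqvGen _ x y at h
  induction h with
  | rel x y h =>
    rcases h with h | ⟨N, Θ, Θ', rfl, rfl, h⟩
    · exact h.weight_eq α β γ
    · obtain ⟨i, k, σ, o, h⟩ := h.exists_isSlideMap
      exact h.weight_eq α β γ
  | refl => rfl
  | symm _ _ _ ih => exact ih.symm
  | trans _ _ _ _ _ ih1 ih2 => exact ih1.trans ih2

/-- The weight of a handle slide equivalence class. -/
noncomputable def SqHS.weight (x : SqHS n m) : K :=
  Quotient.lift (fun Θ : Sq n m => Θ.2.weight α β γ)
    (fun _ _ h => weight_eq_of_handleSlide α β γ h) x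

/-- The functional on the free module which extends the weight. -/
noncomputable def weightFunctional : (SqHS n m →₀ K) →ₗ[K] K :=
  Finsupp.linearCombination K (SqHS.weight α β γ)

theorem weightFunctional_basisClass (Θ : Sq n m) :
    weightFunctional α β γ (basisClass K Θ) = Θ.2.weight α β γ :=
  (Finsupp.linearCombination_single K (1 : K) _).trans (one_smul K _)

theorem weightFunctional_sub_smul (Θ Θ' : Sq n m) (δ : K) :
    weightFunctional α β γ (basisClass K Θ - δ • basisClass K Θ') =
      Θ.2.weight α β γ - δ * Θ'.2.weight α β γ := by
  rw [map_sub, map_smul, weightFunctional_basisClass, weightFunctional_basisClass, smul_eq_mul]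

theorem weightFunctional_relation {N : ℕ} {Θ Θ' : Datum N n m} {Γ : Θ.Component} {δ : K}
    (h : Θ.IsDeletion Γ Θ') (hδ : Γ.factor α β γ = δ) :
    weightFunctional α β γ (basisClass K ⟨N, Θ⟩ - δ • basisClass K ⟨N, Θ'⟩) = 0 := by
  refine (weightFunctional_sub_smul α β γ _ _ δ).trans ?_
  rw [← hδ]
  exact sub_eq_zero.2 (Datum.weight_of_isDeletion h)

/-- A relation is killed because the weight is multiplicative under deletion, once its parameter is
recognised as the factor of the deleted component. -/
theorem relations_le_ker :
    relationsA α n m ⊔ relationsB β n m ⊔ relationsC γ n m ≤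
      LinearMap.ker (weightFunctional (n := n) (m := m) α β γ) := by
  refine sup_le (sup_le ?_ ?_) ?_ <;> refine Submodule.span_le.2 ?_
  · rintro _ ⟨N, Θ, Θ', Γ, hi, hs, hd, rfl⟩
    refine weightFunctional_relation α β γ hd ?_
    rw [Datum.Component.factor, if_pos hi, if_pos ((Datum.Component.isSeparating_iff hi).1 hs)]
  · rintro _ ⟨N, Θ, Θ', Γ, hi, ht, hd, rfl⟩
    refine weightFunctional_relation α β γ hd ?_
    rw [Datum.Component.factor, if_pos hi, if_neg fun he => ?_, if_pos ht]
    rw [Datum.Component.twist_eq_zero_of_even he] at ht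
    exact zero_ne_one ht
  · rintro _ ⟨N, Θ, Θ', Γ, hi, hs, ht, hd, rfl⟩
    refine weightFunctional_relation α β γ hd ?_
    rw [Datum.Component.factor, if_pos hi, if_neg (fun he =>
      hs ((Datum.Component.isSeparating_iff hi).2 he)), if_neg (by rw [ht]; exact zero_ne_one)]

/-- The functional on morphisms which sends a homogeneous morphism to its weight. -/
noncomputable def morphismWeight : SQ α β γ n m →ₗ[K] K :=
  Submodule.liftQ _ (weightFunctional α β γ) (relations_le_ker α β γ)

theorem morphismWeight_hom (Θ : Sq n m) :
    morphismWeight α β γ (hom α β γ Θ) = Θ.2.weight α β γ :=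
  weightFunctional_basisClass α β γ Θ

theorem Sq.WithoutInternal.weight_eq_one {Θ : Sq n m} (h : Θ.WithoutInternal) :
    Θ.2.weight α β γ = 1 :=
  Finset.prod_eq_one fun Γ _ => if_neg (h Γ)

theorem hom_eq_smul_of_relation {N : ℕ} {Θ Θ' : Datum N n m} {δ : K}
    (h : basisClass K ⟨N, Θ⟩ - δ • basisClass K ⟨N, Θ'⟩ ∈
      relationsA α n m ⊔ relationsB β n m ⊔ relationsC γ n m) :
    hom α β γ ⟨N, Θ⟩ = δ • hom α β γ ⟨N, Θ'⟩ :=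
  (Submodule.Quotient.eq _).2 h

end Morphisms

/-- An internal component has no vertices at the two end sites, so the type stays `(n, m)`; it is
nonempty, so the number of vertices drops. -/
theorem Datum.exists_isDeletion {N n m : ℕ} {Θ : Datum N n m} {Γ : Θ.Component}
    (hΓ : Γ.IsInternal) : ∃ Θ' : Datum N n m, Θ.IsDeletion Γ Θ' ∧
      Nat.card Θ'.frame.Vertex < Nat.card Θ.frame.Vertex := by
  have hcount : ∀ j, ¬ IsInner j → {v | v ∈ Γ.suppᶜ ∧ v.site = j}.ncard = Θ.frame.f j := by
    intro j hj
    rw [← Frame.ncard_site]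
    refine congrArg Set.ncard (Set.ext fun v => and_iff_right_of_imp fun hv hvΓ => hj ?_)
    exact hv ▸ hΓ v hvΓ
  obtain ⟨Θ', h⟩ := Datum.exists_isRestriction (Datum.isInvariant_compl_supp Γ) (n' := n)
    (m' := m) (by rw [hcount _ fun h => h.1 rfl, Θ.frame.f_zero])
    (by rw [hcount _ fun h => h.2 rfl, Θ.frame.f_last])
  refine ⟨Θ', h, ?_⟩
  obtain ⟨-, -, o, -⟩ := h
  obtain ⟨v, hv⟩ := Datum.exists_componentOf Γ
  have hlt : (Γ.suppᶜ).ncard < (Set.univ : Set Θ.frame.Vertex).ncard :=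
    Set.ncard_lt_ncard (Set.ssubset_univ_iff.2 fun h =>
      (Set.eq_univ_iff_forall.1 h v : v ∈ Γ.suppᶜ) hv) (Set.toFinite _)
  rw [Set.ncard_univ] at hlt
  rw [← Nat.card_congr o.toEquiv]
  exact hlt

/-! ### Existence and uniqueness of the exponents -/

theorem exists_hom_eq_monomial_smul {n m : ℕ} (Θ : Sq n m) :
    ∃ (a b c : ℕ) (Θ' : Sq n m), Θ'.WithoutInternal ∧
      ∀ (K : Type*) [CommRing K] (α β γ : K),
        hom α β γ Θ = (α ^ a * β ^ b * γ ^ c) • hom α β γ Θ' := by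
  obtain ⟨N, Θ⟩ := Θ
  induction hd : Nat.card Θ.frame.Vertex using Nat.strong_induction_on generalizing Θ with
  | _ d ih
  subst hd
  by_cases hw : Sq.WithoutInternal ⟨N, Θ⟩
  · exact ⟨0, 0, 0, ⟨N, Θ⟩, hw, fun K _ α β γ => by simp⟩
  unfold Sq.WithoutInternal at hw
  push Not at hw
  obtain ⟨Γ, hΓ⟩ := hw
  obtain ⟨Θ₁, hdel, hlt⟩ := Datum.exists_isDeletion hΓ
  obtain ⟨a, b, c, Θ', hΘ', h⟩ := ih _ hlt Θ₁ rfl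
  by_cases hs : Γ.IsSeparating
  · refine ⟨a + 1, b, c, Θ', hΘ', fun K _ α β γ => ?_⟩
    rw [hom_eq_smul_of_relation α β γ (δ := α) (Submodule.mem_sup_left (Submodule.mem_sup_left
      (Submodule.subset_span ⟨N, Θ, Θ₁, Γ, hΓ, hs, hdel, rfl⟩))), h, smul_smul]
    congr 1
    ring
  · rcases (by decide : ∀ t : ZMod 2, t = 0 ∨ t = 1) Γ.twist with ht | ht
    · refine ⟨a, b, c + 1, Θ', hΘ', fun K _ α β γ => ?_⟩
      rw [hom_eq_smul_of_relation α β γ (δ := γ) (Submodule.mem_sup_right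
        (Submodule.subset_span ⟨N, Θ, Θ₁, Γ, hΓ, hs, ht, hdel, rfl⟩)), h, smul_smul]
      congr 1
      ring
    · refine ⟨a, b + 1, c, Θ', hΘ', fun K _ α β γ => ?_⟩
      rw [hom_eq_smul_of_relation α β γ (δ := β) (Submodule.mem_sup_left (Submodule.mem_sup_right
        (Submodule.subset_span ⟨N, Θ, Θ₁, Γ, hΓ, ht, hdel, rfl⟩))), h, smul_smul]
      congr 1
      ring

end SWB

theorem mainTheorem8 {n m : ℕ} (Θ : SWB.Sq n m) :
    ∃ (a b c : ℕ) (Θ' : SWB.Sq n m), Θ'.WithoutInternal ∧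
      ∀ (K : Type*) [CommRing K] (α β γ : K),
        SWB.hom α β γ Θ = (α ^ a * β ^ b * γ ^ c) • SWB.hom α β γ Θ' ∧
        (Function.Injective (fun t : ℕ × ℕ × ℕ => α ^ t.1 * β ^ t.2.1 * γ ^ t.2.2) →
          ∀ (a' b' c' : ℕ) (Θ'' : SWB.Sq n m), Θ''.WithoutInternal →
            SWB.hom α β γ Θ = (α ^ a' * β ^ b' * γ ^ c') • SWB.hom α β γ Θ'' →
            a' = a ∧ b' = b ∧ c' = c) := by
  obtain ⟨a, b, c, Θ', hΘ', h⟩ := SWB.exists_hom_eq_monomial_smul Θ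
  refine ⟨a, b, c, Θ', hΘ', fun K _ α β γ => ⟨h K α β γ, fun hinj a' b' c' Θ'' hΘ'' h' => ?_⟩⟩
  -- Both reduced data have weight `1`, so the linear form leaves an equality of monomials.
  have h1 := congrArg (SWB.morphismWeight α β γ) (h'.symm.trans (h K α β γ))
  rw [map_smul, map_smul, SWB.morphismWeight_hom, SWB.morphismWeight_hom,
    hΘ''.weight_eq_one, hΘ'.weight_eq_one, smul_eq_mul, smul_eq_mul, mul_one, mul_one] at h1
  have h2 := hinj (a₁ := (a', b', c')) (a₂ := (a, b, c)) h1
  simpa using h2
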